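/- Let $\epsilon=(\epsilon_y)_{y\in\mathbb Z}$ be a stationary family of $\{-1,+1\}$-valued random variables on a probability space, with joint law $\nu$ on $\{-1,+1\}^{\mathbb Z}$. Assume that (i) each $\epsilon_y$ is symmetric, i.e. $\mathbb P[\epsilon_y=1]=\mathbb P[\epsilon_y=-1]=\frac12$; (ii) the family is associated (FKG): for every $m\ge 0$ and all coordinatewise nondecreasing functions $f,g:\{-1,+1\}^{m+1}\to\mathbb R$, $\mathrm{Cov}\big[f(\epsilon_0,\dots,\epsilon_m),\,g(\epsilon_0,\dots,\epsilon_m)\big]\ge 0$; (iii) there is $\alpha>1$ such that $\mathbb E[\epsilon_0\epsilon_y]=\mathcal O(|y|^{-\alpha})$ as $|y|\to\infty$. For a realization $\epsilon$, let $\mathbb L^{\epsilon}$ be the directed graph with vertex set $\mathbb Z^2$ in which there is an edge from $u=(u_1,u_2)$ to $v=(v_1,v_2)$ if and only if either $v_1=u_1$ and $v_2=u_2\pm1$, or $v_2=u_2$ and $v_1=u_1+\epsilon_{u_2}$. The simple random walk on $\mathbb L^{\epsilon}$ is the Markov chain on $\mathbb Z^2$ that jumps from $u$ to each of the three vertices $v$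 such that $(u,v)$ is an edge with probability $\frac13$. Then for $\nu$-almost every realization of $\epsilon$, the simple random walk on $\mathbb L^{\epsilon}$ is transient: for every starting vertex, almost surely, every vertex is visited only finitely many times. -/

import Mathlib

open MeasureTheory ProbabilityTheory Filter Asymptotics

namespace OrientedLattice

noncomputable section

/-! ### Random orientations

The two-point set of orientations is `ℤˣ = {-1, 1}`, ordered by `-1 < 1`. A random field of
orientations is a family `ε : ℤ → Ω → ℤˣ`. -/

/-- The law, on `{-1, 1}^ℤ`, of the field `ε` under `P`. -/
def fieldLaw {Ω : Type*} [MeasurableSpace Ω] (P : Measure Ω) (ε : ℤ → Ω → ℤˣ) :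
    Measure (ℤ → ℤˣ) :=
  P.map (fun ω y => ε y ω)

/-- Stationarity: the joint law of the field is invariant under every shift of `ℤ`. -/
def IsStationary {Ω : Type*} [MeasurableSpace Ω] (P : Measure Ω) (ε : ℤ → Ω → ℤˣ) : Prop :=
  ∀ k : ℤ, fieldLaw P (fun y => ε (y + k)) = fieldLaw P ε

/-- Each variable of the field is symmetric: `-ε y` has the same law as `ε y`. -/
def IsSymmetric {Ω : Type*} [MeasurableSpace Ω] (P : Measure Ω) (ε : ℤ → Ω → ℤˣ) : Prop :=
  ∀ y : ℤ, P.map (fun ω => -ε y ω) = P.map (ε y)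

/-- Association (positive correlations, FKG): coordinatewise nondecreasing functions of
`(ε 0, …, ε m)` have nonnegative covariance, for every `m`. -/
def IsAssociated {Ω : Type*} [MeasurableSpace Ω] (P : Measure Ω) (ε : ℤ → Ω → ℤˣ) : Prop :=
  ∀ (m : ℕ) (f g : (Fin (m + 1) → ℤˣ) → ℝ), Monotone f → Monotone g →
    0 ≤ cov[fun ω => f (fun i => ε (i : ℕ) ω), fun ω => g (fun i => ε (i : ℕ) ω); P]

/-- The correlation `E[ε 0 * ε y]`. -/
def correlation {Ω : Type*} [MeasurableSpace Ω] (P : Measure Ω) (ε : ℤ → Ω → ℤˣ) (y : ℤ) : ℝ :=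
  ∫ ω, (((ε 0 ω : ℤˣ) : ℤ) : ℝ) * (((ε y ω : ℤˣ) : ℤ) : ℝ) ∂P

/-! ### The lattice and its simple random walk -/

/-- The horizontally oriented lattice: vertical edges in both directions, and at level `y`
horizontal edges in the direction `e y` only. -/
def lattice (e : ℤ → ℤˣ) : Digraph (ℤ × ℤ) where
  Adj u v := (v.1 = u.1 ∧ (v.2 = u.2 + 1 ∨ v.2 = u.2 - 1)) ∨
    (v.2 = u.2 ∧ v.1 = u.1 + (e u.2 : ℤ))

open Classical in
/-- One-step transition probability of the simple random walk. -/
def transitionProb (e : ℤ → ℤˣ) (u v : ℤ × ℤ) : ENNReal :=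
  if (lattice e).Adj u v then 1 / 3 else 0

theorem hasSum_transitionProb (e : ℤ → ℤˣ) (u : ℤ × ℤ) :
    HasSum (transitionProb e u) 1 := by
  classical
  obtain ⟨a, b⟩ := u
  have he : (e b : ℤ) ≠ 0 := (e b).ne_zero
  have hs : ∀ v ∉ ({(a, b + 1), (a, b - 1), (a + (e b : ℤ), b)} : Finset (ℤ × ℤ)),
      transitionProb e (a, b) v = 0 := by
    rintro ⟨c, d⟩ hv
    refine if_neg ?_
    simp only [Finset.mem_insert, Finset.mem_singleton, Prod.mk.injEq] at hv
    simp only [lattice]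
    tauto
  have h : HasSum (transitionProb e (a, b))
      (∑ v ∈ ({(a, b + 1), (a, b - 1), (a + (e b : ℤ), b)} : Finset (ℤ × ℤ)),
        transitionProb e (a, b) v) := hasSum_sum_of_ne_finset_zero hs
  convert h using 1
  rw [Finset.sum_insert (by simp [he]; omega), Finset.sum_insert (by simp),
    Finset.sum_singleton]
  simp only [transitionProb, lattice, true_and, true_or, or_true, if_true]
  rw [← add_assoc, ENNReal.add_thirds]

/-- The law of one step of the walk from `u`. -/
def step (e : ℤ → ℤˣ) (u : ℤ × ℤ) : PMF (ℤ × ℤ) :=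
  ⟨transitionProb e u, hasSum_transitionProb e u⟩

/-- Given the path up to time `n`, the law of the position at time `n + 1`. -/
def stepKernel (e : ℤ → ℤˣ) (n : ℕ) : Kernel (Finset.Iic n → ℤ × ℤ) (ℤ × ℤ) where
  toFun x := (step e (x ⟨n, Finset.mem_Iic.2 le_rfl⟩)).toMeasure
  measurable' :=
    (measurable_of_countable (fun u : ℤ × ℤ => (step e u).toMeasure)).comp (measurable_pi_apply _)

instance (e : ℤ → ℤˣ) (n : ℕ) : IsMarkovKernel (stepKernel e n) :=
  ⟨fun _ => PMF.toMeasure.isProbabilityMeasure _⟩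

/-- The law on path space of the simple random walk on `lattice e` started at `u`, that is, of
the Markov chain with initial law `δ_u` and transition probabilities `transitionProb e`. -/
def walkLaw (e : ℤ → ℤˣ) (u : ℤ × ℤ) : Measure (ℕ → ℤ × ℤ) :=
  Kernel.trajMeasure (X := fun _ => ℤ × ℤ) (Measure.dirac u) (stepKernel e)

/-- The simple random walk on `lattice e` is transient: from every starting point, almost surely,
every vertex is visited only finitely many times. -/
def IsTransient (e : ℤ → ℤˣ) : Prop :=
  ∀ u v : ℤ × ℤ, ∀ᵐ M ∂(walkLaw e u), {n : ℕ | M n = v}.Finite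

end

end OrientedLattice

namespace OrientedLattice

noncomputable section

open scoped ENNReal

/-! ### Transience from a supersolution of the Green equation -/

/-! The vertical moves form a simple random walk on ℤ, and at each level visited the walk makes an
independent geometric number ξ of horizontal steps, P(ξ = k) = (2/3)(1/3)^k, all in the direction of
that level. Grouping visits by the number m of vertical steps gives an explicit solution `green` of
the Green equation (`green_eq`). Where finite, such a solution dominates the expected number of
visits, and Borel–Cantelli gives transience (`isTransient_of_supersolution`). So it suffices that
`green` has finite ν-integral for each of the countably many pairs of vertices
(`lintegral_green_ne_top`).

Fix a vertical path with m steps and local times n_z, and let S = ∑ n_z ε_z. The horizontal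
displacement has mean S/2. Its point masses are always O(m^(-1/2)) (`horizLaw_le_inv_sqrt`), and at
a fixed point they are smaller than any power of m once |S| > m^(1/2+δ) (`horizLaw_le_exp_neg_abs`).
Prescribing the vertical endpoint costs another m^(-1/2) (`hitProb_le`). The m-th term is therefore
O(m^(-1-δ)), hence summable, once ν(|S| ≤ m^(1/2+δ)) = O(m^(-δ)), which is
`measureReal_abs_signSum_le`. It is plausible since, outside a negligible set of paths
(`pathAvg_not_spread_le`), ∑ n_z² is m^(3/2) up to factors m^(±δ), and positive correlations only
increase the variance of S.

The anticoncentration uses characteristic functions. By Newman's inequality, association makes the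
characteristic function of S factorise over blocks of levels, up to the covariance between blocks
(`norm_charAt_sub_prod_le`). The decay α > 1, with a good choice of block grid, makes this
covariance small (`exists_shift_crossCov_le`), and each block factor is at most a Gaussian one. A
Fejér kernel turns the bound into a small-ball estimate (`measureReal_abs_le_le`). -/

/-- The transition operator of the walk. -/
def stepOp (e : ℤ → ℤˣ) (f : ℤ × ℤ → ℝ≥0∞) (u : ℤ × ℤ) : ℝ≥0∞ :=
  3⁻¹ * (f (u.1, u.2 + 1) + f (u.1, u.2 - 1) + f (u.1 + (e u.2 : ℤ), u.2))

theorem tsum_transitionProb_mul (e : ℤ → ℤˣ) (f : ℤ × ℤ → ℝ≥0∞) (u : ℤ × ℤ) :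
    ∑' v, transitionProb e u v * f v = stepOp e f u := by
  classical
  obtain ⟨a, b⟩ := u
  have he : (e b : ℤ) ≠ 0 := (e b).ne_zero
  rw [tsum_eq_sum (s := {(a, b + 1), (a, b - 1), (a + (e b : ℤ), b)})]
  · rw [Finset.sum_insert (by simp [he]; omega), Finset.sum_insert (by simp),
      Finset.sum_singleton]
    simp only [transitionProb, lattice, true_and, true_or, or_true, if_true, stepOp, one_div]
    ring
  · rintro ⟨c, d⟩ hv
    have : transitionProb e (a, b) (c, d) = 0 := by
      refine if_neg ?_
      simp only [Finset.mem_insert, Finset.mem_singleton, Prod.mk.injEq] at hv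
      simp only [lattice]
      tauto
    simp [this]

theorem lintegral_step (e : ℤ → ℤˣ) (f : ℤ × ℤ → ℝ≥0∞) (u : ℤ × ℤ) :
    ∫⁻ v, f v ∂(step e u).toMeasure = stepOp e f u := by
  rw [lintegral_countable', ← tsum_transitionProb_mul]
  refine tsum_congr fun v => ?_
  rw [PMF.toMeasure_apply_singleton _ _ (measurableSet_singleton v), mul_comm]
  rfl

instance (e : ℤ → ℤˣ) (u : ℤ × ℤ) : IsProbabilityMeasure (walkLaw e u) := by
  unfold walkLaw; infer_instance

/-- Markov property: the joint law of the path up to time n and the next position is a composition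
product with `stepKernel`, so integrating out the last coordinate applies `stepOp` once. -/
theorem lintegral_walkLaw_succ (e : ℤ → ℤˣ) (u : ℤ × ℤ) (f : ℤ × ℤ → ℝ≥0∞) (n : ℕ) :
    ∫⁻ M, f (M (n + 1)) ∂(walkLaw e u) = ∫⁻ M, stepOp e f (M n) ∂(walkLaw e u) := by
  have hf : Measurable f := measurable_of_countable f
  have hK : Measurable (stepOp e f) := measurable_of_countable _
  have h := Kernel.map_frestrictLe_trajMeasure_compProd_eq_map_trajMeasure
    (X := fun _ => ℤ × ℤ) (μ₀ := Measure.dirac u) (κ := stepKernel e) (a := n)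
  have h2 := congrArg (fun μ => ∫⁻ p, f p.2 ∂μ) h
  beta_reduce at h2
  rw [Measure.lintegral_compProd (by fun_prop), lintegral_map (by fun_prop) (by fun_prop),
    lintegral_map (by fun_prop) (by fun_prop)] at h2
  unfold walkLaw
  rw [← h2]
  refine lintegral_congr fun M => ?_
  exact lintegral_step e f _

theorem lintegral_walkLaw_zero (e : ℤ → ℤˣ) (u : ℤ × ℤ) (f : ℤ × ℤ → ℝ≥0∞) :
    ∫⁻ M, f (M 0) ∂(walkLaw e u) = f u := by
  have hf : Measurable f := measurable_of_countable f
  set x₀ : Finset.Iic 0 → ℤ × ℤ :=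
    (MeasurableEquiv.piUnique (fun _ : Finset.Iic 0 => ℤ × ℤ)).symm u with hx₀
  have hw : walkLaw e u = Kernel.traj (X := fun _ => ℤ × ℤ) (stepKernel e) 0 x₀ := by
    unfold walkLaw Kernel.trajMeasure
    rw [Measure.map_dirac' (by fun_prop), Measure.dirac_bind (Kernel.measurable _)]
  have h := Kernel.traj_map_frestrictLe_of_le (X := fun _ => ℤ × ℤ) (κ := stepKernel e)
    (le_refl 0)
  have h2 := congrArg (fun κ => ∫⁻ x, f (x ⟨0, by simp⟩) ∂(κ x₀)) h
  beta_reduce at h2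
  rw [Kernel.map_apply _ (by fun_prop), lintegral_map (by fun_prop) (by fun_prop),
    Kernel.lintegral_deterministic' _ (by fun_prop)] at h2
  rw [hw]
  exact h2

theorem lintegral_walkLaw (e : ℤ → ℤˣ) (u : ℤ × ℤ) (n : ℕ) (f : ℤ × ℤ → ℝ≥0∞) :
    ∫⁻ M, f (M n) ∂(walkLaw e u) = (stepOp e)^[n] f u := by
  induction n generalizing f with
  | zero => exact lintegral_walkLaw_zero e u f
  | succ n ih => rw [lintegral_walkLaw_succ, ih, Function.iterate_succ_apply]

theorem stepOp_mono (e : ℤ → ℤˣ) : Monotone (stepOp e) := by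
  intro f g h u
  unfold stepOp
  gcongr <;> exact h _

theorem stepOp_sum (e : ℤ → ℤˣ) (s : Finset ℕ) (f : ℕ → ℤ × ℤ → ℝ≥0∞) :
    stepOp e (∑ i ∈ s, f i) = ∑ i ∈ s, stepOp e (f i) := by
  ext u
  simp [stepOp, Finset.sum_apply, Finset.mul_sum, Finset.sum_add_distrib, mul_add]

/-- Minimality of the Green function: each partial sum is f plus the operator applied to the
previous one, so the supersolution inequality propagates the bound. -/
theorem sum_iterate_stepOp_le (e : ℤ → ℤˣ) {f h : ℤ × ℤ → ℝ≥0∞}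
    (hh : f + stepOp e h ≤ h) (n : ℕ) : ∑ i ∈ Finset.range n, (stepOp e)^[i] f ≤ h := by
  induction n with
  | zero => simp
  | succ n ih =>
    rw [Finset.sum_range_succ', add_comm]
    refine le_trans ?_ hh
    simp only [Function.iterate_succ_apply', Function.iterate_zero, id]
    rw [← stepOp_sum]
    gcongr
    exact stepOp_mono e ih

/-- For f the indicator of v, the n-th iterate at u is the probability of being at v at time n.
These are summable by comparison with h, and Borel–Cantelli concludes. -/
theorem isTransient_of_supersolution (e : ℤ → ℤˣ) (h : ℤ × ℤ → ℤ × ℤ → ℝ≥0∞)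
    (hh : ∀ v, Pi.single v 1 + stepOp e (h v) ≤ h v) (hfin : ∀ v u, h v u ≠ ∞) :
    IsTransient e := by
  intro u v
  have key : ∑' n, walkLaw e u {M | M n = v} ≤ h v u := by
    refine ENNReal.tsum_le_of_sum_range_le fun n => ?_
    have := sum_iterate_stepOp_le e (hh v) n u
    rw [Finset.sum_apply] at this
    refine le_trans (le_of_eq (Finset.sum_congr rfl fun i _ => ?_)) this
    rw [← lintegral_walkLaw]
    have hm : MeasurableSet {M : ℕ → ℤ × ℤ | M i = v} :=
      (measurableSet_singleton v).preimage (measurable_pi_apply i)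
    rw [← lintegral_indicator_one hm]
    refine lintegral_congr fun M => ?_
    simp [Set.indicator_apply, Pi.single_apply]
  exact ae_finite_setOfPred_mem (ne_top_of_le_ne_top (hfin v u) key)

/-! ### Horizontal displacement along a vertical path -/

/-- The point masses of `∑ σ ξ_σ`, the sum running over the signs `σ` in a list and the `ξ_σ`
being independent geometric variables with `P(ξ = k) = (2/3) (1/3)^k`. -/
def horizLaw : List ℤˣ → ℤ → ℝ≥0∞
  | [], x => if x = 0 then 1 else 0
  | σ :: l, x => ∑' k : ℕ, 2 * 3⁻¹ ^ (k + 1) * horizLaw l (x - k * (σ : ℤ))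

/-- Lack of memory of the geometric law: either ξ = 0, or one step is made and ξ - 1 is again
geometric. -/
theorem horizLaw_cons (σ : ℤˣ) (l : List ℤˣ) (x : ℤ) :
    horizLaw (σ :: l) x = 2 * 3⁻¹ * horizLaw l x + 3⁻¹ * horizLaw (σ :: l) (x - σ) := by
  rw [horizLaw, tsum_eq_zero_add' ENNReal.summable, horizLaw, ← ENNReal.tsum_mul_left]
  simp only [zero_add, pow_one, Nat.cast_zero, zero_mul, sub_zero]
  congr 1
  refine tsum_congr fun k => ?_
  rw [← mul_assoc]
  congr 1
  · ring
  · congr 1; push_cast; ring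

/-- The expectation of `F` over the list of the first `m + 1` positions of a simple random walk
on `ℤ` started at `y`. -/
def pathAvg : ℕ → ℤ → (List ℤ → ℝ≥0∞) → ℝ≥0∞
  | 0, y, F => F [y]
  | m + 1, y, F => 2⁻¹ * (pathAvg m (y + 1) (fun l => F (y :: l)) +
      pathAvg m (y - 1) (fun l => F (y :: l)))

theorem pathAvg_mono' {m : ℕ} {y : ℤ} {F G : List ℤ → ℝ≥0∞}
    (h : ∀ l, l.length = m + 1 → F l ≤ G l) : pathAvg m y F ≤ pathAvg m y G := by
  induction m generalizing y F G with
  | zero => exact h _ rfl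
  | succ m ih =>
    unfold pathAvg
    gcongr <;> exact ih fun l hl => h _ (by simp [hl])

theorem pathAvg_add (m : ℕ) (y : ℤ) (F G : List ℤ → ℝ≥0∞) :
    pathAvg m y (fun l => F l + G l) = pathAvg m y F + pathAvg m y G := by
  induction m generalizing y F G with
  | zero => rfl
  | succ m ih => simp only [pathAvg, ih]; ring

theorem pathAvg_const_mul (m : ℕ) (y : ℤ) (c : ℝ≥0∞) (F : List ℤ → ℝ≥0∞) :
    pathAvg m y (fun l => c * F l) = c * pathAvg m y F := by
  induction m generalizing y F with
  | zero => rfl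
  | succ m ih => simp only [pathAvg, ih]; ring

theorem pathAvg_const (m : ℕ) (y : ℤ) (c : ℝ≥0∞) : pathAvg m y (fun _ => c) = c := by
  induction m generalizing y with
  | zero => rfl
  | succ m ih =>
    simp only [pathAvg, ih]
    rw [← two_mul, ← mul_assoc, ENNReal.inv_mul_cancel (by simp) (by simp), one_mul]

theorem pathAvg_congr {m : ℕ} {y : ℤ} {F G : List ℤ → ℝ≥0∞}
    (h : ∀ l, l.length = m + 1 → F l = G l) : pathAvg m y F = pathAvg m y G :=
  le_antisymm (pathAvg_mono' fun l hl => (h l hl).le) (pathAvg_mono' fun l hl => (h l hl).ge)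

/-- The contribution to the Green function at `v` of the vertical paths with `m` steps. -/
def greenTerm (e : ℤ → ℤˣ) (v : ℤ × ℤ) (m : ℕ) (u : ℤ × ℤ) : ℝ≥0∞ :=
  pathAvg m u.2 fun l =>
    (if l.getLast? = some v.2 then 1 else 0) * horizLaw (l.map e) (v.1 - u.1)

/-- The Green function `∑ n, P(M n = v)` of the walk. -/
def green (e : ℤ → ℤˣ) (v u : ℤ × ℤ) : ℝ≥0∞ := 3 * 2⁻¹ * ∑' m, greenTerm e v m u

theorem greenTerm_zero (e : ℤ → ℤˣ) (v u : ℤ × ℤ) :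
    greenTerm e v 0 u = 2 * 3⁻¹ * (Pi.single v 1 : ℤ × ℤ → ℝ≥0∞) u +
      3⁻¹ * greenTerm e v 0 (u.1 + e u.2, u.2) := by
  simp only [greenTerm, pathAvg, List.map_cons, List.map_nil]
  rw [horizLaw_cons, mul_add, sub_sub]
  congr 1
  · obtain ⟨a, b⟩ := u
    obtain ⟨c, d⟩ := v
    simp only [List.getLast?_singleton, Option.some.injEq, horizLaw, Pi.single_apply,
      Prod.mk.injEq, sub_eq_zero, @eq_comm _ c a]
    by_cases h1 : b = d <;> by_cases h2 : a = c <;> simp [h1, h2]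
  · ring

theorem greenTerm_succ (e : ℤ → ℤˣ) (v u : ℤ × ℤ) (m : ℕ) :
    greenTerm e v (m + 1) u =
      3⁻¹ * (greenTerm e v m (u.1, u.2 + 1) + greenTerm e v m (u.1, u.2 - 1)) +
      3⁻¹ * greenTerm e v (m + 1) (u.1 + e u.2, u.2) := by
  have hlast : ∀ (l : List ℤ) y, l.length = m + 1 → (y :: l).getLast? = l.getLast? := by
    intro l y hl
    cases l with
    | nil => simp at hl
    | cons a l => simp
  have key : ∀ y', pathAvg m y' (fun l => (if (u.2 :: l).getLast? = some v.2 then 1 else 0) *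
      horizLaw ((u.2 :: l).map e) (v.1 - u.1)) =
      2 * 3⁻¹ * pathAvg m y' (fun l => (if l.getLast? = some v.2 then 1 else 0) *
        horizLaw (l.map e) (v.1 - u.1)) +
      3⁻¹ * pathAvg m y' (fun l => (if (u.2 :: l).getLast? = some v.2 then 1 else 0) *
        horizLaw ((u.2 :: l).map e) (v.1 - (u.1 + e u.2))) := by
    intro y'
    rw [← pathAvg_const_mul, ← pathAvg_const_mul, ← pathAvg_add]
    refine pathAvg_congr fun l hl => ?_
    rw [hlast l _ hl, List.map_cons, horizLaw_cons, sub_sub]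
    ring
  have h2 : (2⁻¹ : ℝ≥0∞) * 2 = 1 := ENNReal.inv_mul_cancel (by simp) (by simp)
  simp only [greenTerm, pathAvg, key]
  generalize pathAvg m (u.2 + 1) _ = A
  generalize pathAvg m (u.2 - 1) _ = B
  generalize pathAvg m (u.2 + 1) _ = C
  generalize pathAvg m (u.2 - 1) _ = D
  calc _ = (2⁻¹ * 2) * (3⁻¹ * (A + B)) + 3⁻¹ * (2⁻¹ * (C + D)) := by ring
    _ = _ := by rw [h2, one_mul]

/-- First-step analysis, summed over m. The factor 3/2 appears because `greenTerm` weighs the last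
level by P(ξ = k) = (2/3) 3^(-k), while a visit after k horizontal steps only requires ξ ≥ k, of
probability 3^(-k). -/
theorem green_eq (e : ℤ → ℤˣ) (v : ℤ × ℤ) :
    Pi.single v 1 + stepOp e (green e v) = green e v := by
  have h32 : (3 : ℝ≥0∞) * 2⁻¹ * (2 * 3⁻¹) = 1 := by
    have h2 : (2⁻¹ : ℝ≥0∞) * 2 = 1 := ENNReal.inv_mul_cancel (by simp) (by simp)
    have h3 : (3 : ℝ≥0∞) * 3⁻¹ = 1 := ENNReal.mul_inv_cancel (by simp) (by simp)
    calc _ = (2⁻¹ * 2) * ((3 : ℝ≥0∞) * 3⁻¹) := by ring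
      _ = 1 := by rw [h2, h3, one_mul]
  ext u
  have : ∑' m, greenTerm e v m u = 2 * 3⁻¹ * (Pi.single v 1 : ℤ × ℤ → ℝ≥0∞) u +
      3⁻¹ * (∑' m, greenTerm e v m (u.1, u.2 + 1) + ∑' m, greenTerm e v m (u.1, u.2 - 1)) +
      3⁻¹ * ∑' m, greenTerm e v m (u.1 + e u.2, u.2) := by
    rw [tsum_eq_zero_add' ENNReal.summable, greenTerm_zero]
    simp only [greenTerm_succ e v u]
    rw [ENNReal.tsum_add, ENNReal.tsum_mul_left, ENNReal.tsum_mul_left, ENNReal.tsum_add,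
      tsum_eq_zero_add' (f := fun m => greenTerm e v m (u.1 + e u.2, u.2)) ENNReal.summable]
    ring
  rw [Pi.add_apply, green, this]
  simp only [stepOp, green]
  calc _ = 1 * (Pi.single v 1 : ℤ × ℤ → ℝ≥0∞) u + _ := by rw [one_mul]
    _ = _ := by rw [← h32]; ring

/-! ### Exponential and local bounds for the horizontal displacement -/

/-- The moment generating function of `σ ξ`, for `ξ` geometric. -/
def geomMgf (s : ℝ) (σ : ℤˣ) : ℝ≥0∞ :=
  ∑' k : ℕ, 2 * 3⁻¹ ^ (k + 1) * ENNReal.ofReal (Real.exp (s * (k * (σ : ℤ))))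

theorem tsum_horizLaw_mul_exp (s : ℝ) (l : List ℤˣ) :
    ∑' x : ℤ, horizLaw l x * ENNReal.ofReal (Real.exp (s * x)) = (l.map (geomMgf s)).prod := by
  induction l with
  | nil =>
    rw [tsum_eq_single 0]
    · simp [horizLaw]
    · intro x hx
      simp [horizLaw, hx]
  | cons σ l ih =>
    simp only [horizLaw, ← ENNReal.tsum_mul_right]
    rw [ENNReal.tsum_comm, List.map_cons, List.prod_cons, ← ih, geomMgf, ← ENNReal.tsum_mul_right]
    refine tsum_congr fun k => ?_
    rw [← (Equiv.addRight ((k : ℤ) * (σ : ℤ))).tsum_eq, ← ENNReal.tsum_mul_left]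
    refine tsum_congr fun x => ?_
    simp only [Equiv.coe_addRight, add_sub_cancel_right]
    push_cast
    rw [mul_add, Real.exp_add, ENNReal.ofReal_mul (Real.exp_pos _).le]
    ring

/-- The generating function equals (2/3)/(1 - e^t/3) with t = sσ. The linear term in the exponent is
the mean 1/2 of ξ; for |t| ≤ 1/4 the square term absorbs everything else. -/
theorem geomMgf_le {s : ℝ} (hs : |s| ≤ 1 / 4) (σ : ℤˣ) :
    geomMgf s σ ≤ ENNReal.ofReal (Real.exp (s * ((σ : ℤ) : ℝ) / 2 + s ^ 2)) := by
  obtain ⟨t, ht⟩ : ∃ t, t = s * ((σ : ℤ) : ℝ) := ⟨_, rfl⟩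
  have hts : |t| = |s| := by
    rw [ht, abs_mul]
    rcases Int.units_eq_one_or σ with h | h <;> simp [h]
  have hts2 : s ^ 2 = t ^ 2 := by rw [← sq_abs, ← hts, sq_abs]
  have ht4 : |t| ≤ 1 / 4 := hts ▸ hs
  have hE : Real.exp t ≤ 1 + t + t ^ 2 := by
    have := Real.abs_exp_sub_one_sub_id_le (x := t) (by linarith)
    rw [abs_le] at this; linarith
  obtain ⟨h1, h2⟩ := abs_le.1 ht4
  have hE3 : Real.exp t ≤ 2 := by nlinarith
  have hgeom : HasSum (fun k : ℕ => (2 / 3 : ℝ) * (Real.exp t / 3) ^ k)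
      (2 / 3 * (1 - Real.exp t / 3)⁻¹) :=
    (hasSum_geometric_of_lt_one (by positivity) (by linarith)).mul_left _
  have hval : geomMgf s σ = ENNReal.ofReal (2 / 3 * (1 - Real.exp t / 3)⁻¹) := by
    rw [← hgeom.tsum_eq, ENNReal.ofReal_tsum_of_nonneg (fun k => by positivity) hgeom.summable]
    refine tsum_congr fun k => ?_
    have : s * (k * ((σ : ℤ) : ℝ)) = k * t := by rw [ht]; ring
    rw [this, Real.exp_nat_mul, ENNReal.ofReal_mul (by norm_num), div_pow,
      div_eq_mul_inv (Real.exp t ^ k), ENNReal.ofReal_mul (by positivity),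
      ENNReal.ofReal_div_of_pos (by norm_num), ENNReal.ofReal_inv_of_pos (by positivity),
      ENNReal.ofReal_pow (by norm_num : (0 : ℝ) ≤ 3)]
    simp only [ENNReal.ofReal_ofNat, div_eq_mul_inv, ENNReal.inv_pow]
    ring
  rw [hval, ← ht, hts2]
  refine ENNReal.ofReal_le_ofReal ?_
  have h3 : 1 + t / 2 + t ^ 2 ≤ Real.exp (t / 2 + t ^ 2) := by
    linarith [Real.add_one_le_exp (t / 2 + t ^ 2)]
  rw [← div_eq_mul_inv, div_le_iff₀ (by linarith)]
  have h4 : 2 ≤ (3 - Real.exp t) * Real.exp (t / 2 + t ^ 2) := by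
    -- The linear terms cancel: the product is 2 + t²/2 - (3/2)t³ - t⁴.
    calc (2 : ℝ) ≤ (2 - t - t ^ 2) * (1 + t / 2 + t ^ 2) := by
          nlinarith [sq_nonneg t, mul_nonneg (sq_nonneg t) (sub_nonneg.2 h2), sq_nonneg (t ^ 2),
            mul_nonneg (sq_nonneg t) (mul_nonneg (sub_nonneg.2 h2) (by linarith : 0 ≤ 1 / 4 + t))]
      _ ≤ _ := by
          apply mul_le_mul _ h3 (by nlinarith [sq_nonneg (t + 1/4)]) (by linarith)
          linarith
  linarith

/-- The sum of a list of signs. -/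
def signSum (l : List ℤˣ) : ℝ := (l.map fun σ : ℤˣ => ((σ : ℤ) : ℝ)).sum

/-- Chernoff's bound: a single term of the moment generating series is at most its sum. -/
theorem horizLaw_le_exp {s : ℝ} (hs : |s| ≤ 1 / 4) (l : List ℤˣ) (x : ℤ) :
    horizLaw l x ≤
      ENNReal.ofReal (Real.exp (s * signSum l / 2 + s ^ 2 * l.length - s * x)) := by
  have h1 : (l.map (geomMgf s)).prod ≤
      ENNReal.ofReal (Real.exp (s * signSum l / 2 + s ^ 2 * l.length)) := by
    clear x
    induction l with
    | nil => simp [signSum]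
    | cons σ l ih =>
      rw [List.map_cons, List.prod_cons]
      refine (mul_le_mul' (geomMgf_le hs σ) ih).trans (le_of_eq ?_)
      rw [← ENNReal.ofReal_mul (by positivity), ← Real.exp_add]
      simp only [signSum, List.map_cons, List.sum_cons, List.length_cons]
      push_cast
      congr 2
      ring
  have h2 : horizLaw l x * ENNReal.ofReal (Real.exp (s * x)) ≤ (l.map (geomMgf s)).prod := by
    rw [← tsum_horizLaw_mul_exp]
    exact ENNReal.le_tsum x
  calc horizLaw l x = horizLaw l x * ENNReal.ofReal (Real.exp (s * x)) *
        ENNReal.ofReal (Real.exp (-(s * x))) := by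
        rw [mul_assoc, ← ENNReal.ofReal_mul (by positivity), ← Real.exp_add]; simp
    _ ≤ _ := mul_le_mul_left (h2.trans h1) _
    _ = _ := by
        rw [← ENNReal.ofReal_mul (by positivity), ← Real.exp_add, sub_eq_add_neg]

/-- Take |s| = length^(-1/2), of sign opposite to the sign sum: the quadratic term becomes 1, and
length at least 16 is exactly what |s| ≤ 1/4 requires. -/
theorem horizLaw_le_exp_neg_abs {l : List ℤˣ} (hl : 16 ≤ l.length) (x : ℤ) :
    horizLaw l x ≤
      ENNReal.ofReal (Real.exp (1 + |(x : ℝ)| - |signSum l| / (2 * √l.length))) := by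
  have h4 : (4 : ℝ) ≤ √l.length := by
    rw [show (4 : ℝ) = √16 by rw [show (16 : ℝ) = 4 ^ 2 by norm_num]; simp]
    exact Real.sqrt_le_sqrt (by exact_mod_cast hl)
  have hpos : 0 < √(l.length : ℝ) := by linarith
  have hsq : √(l.length : ℝ) ^ 2 = l.length := Real.sq_sqrt (by positivity)
  have hr : (√(l.length : ℝ))⁻¹ ≤ 1 / 4 := by
    rw [inv_le_comm₀ hpos (by norm_num)]; simpa using h4
  have hr0 : 0 < (√(l.length : ℝ))⁻¹ := by positivity
  have hr1 : (√(l.length : ℝ))⁻¹ ^ 2 * l.length = 1 := by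
    nth_rewrite 2 [← hsq]; field_simp
  have key : ∀ s : ℝ, |s| = (√(l.length : ℝ))⁻¹ → s * signSum l =
      -(|signSum l| * (√(l.length : ℝ))⁻¹) → horizLaw l x ≤
      ENNReal.ofReal (Real.exp (1 + |(x : ℝ)| - |signSum l| / (2 * √l.length))) := by
    intro s hs hS
    refine (horizLaw_le_exp (s := s) (by rw [hs]; exact hr) l x).trans ?_
    refine ENNReal.ofReal_le_ofReal (Real.exp_le_exp.2 ?_)
    have e1 : s ^ 2 * l.length = 1 := by rw [← sq_abs, hs, hr1]
    have e2 : -(s * x) ≤ |(x : ℝ)| := by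
      refine (neg_le_abs _).trans ?_
      rw [abs_mul, hs]
      nlinarith [abs_nonneg (x : ℝ)]
    have e3 : |signSum l| / (2 * √l.length) = |signSum l| * (√(l.length : ℝ))⁻¹ / 2 := by
      field_simp
    rw [hS, e1, e3]
    linarith
  rcases le_total 0 (signSum l) with h | h
  · refine key (-(√(l.length : ℝ))⁻¹) (by rw [abs_neg, abs_of_pos hr0]) ?_
    rw [abs_of_nonneg h]; ring
  · refine key ((√(l.length : ℝ))⁻¹) (abs_of_pos hr0) ?_
    rw [abs_of_nonpos h]; ring

/-- The characteristic function of `σ ξ`, for `ξ` geometric. -/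
def geomChar (θ : ℝ) (σ : ℤˣ) : ℂ := 2 / (3 - Complex.exp (((σ : ℤ) : ℂ) * θ * Complex.I))

theorem three_sub_exp_ne_zero (θ : ℝ) : (3 : ℂ) - Complex.exp (θ * Complex.I) ≠ 0 := by
  intro h
  have h1 : ‖Complex.exp (θ * Complex.I)‖ = 1 := Complex.norm_exp_ofReal_mul_I θ
  rw [← sub_eq_zero.1 h] at h1
  norm_num at h1

/-- With y = (1 - cos θ)/2, the squared modulus is 1/(1 + 3y), which is at most e^(-y) on [0, 1].
Finally y ≥ θ²/π² ≥ θ²/10 on [-π, π]. -/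
theorem norm_geomChar_le {θ : ℝ} (hθ : |θ| ≤ Real.pi) (σ : ℤˣ) :
    ‖geomChar θ σ‖ ≤ Real.exp (-(1 / 20) * θ ^ 2) := by
  have hcos : Real.cos (((σ : ℤ) : ℝ) * θ) = Real.cos θ := by
    rcases Int.units_eq_one_or σ with h | h <;> simp [h]
  have hn : ‖(3 : ℂ) - Complex.exp (((σ : ℤ) : ℂ) * θ * Complex.I)‖ ^ 2 =
      10 - 6 * Real.cos θ := by
    rw [show ((σ : ℤ) : ℂ) * θ * Complex.I = ((((σ : ℤ) : ℝ) * θ : ℝ) : ℂ) * Complex.I by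
      push_cast; ring, Complex.sq_norm, Complex.normSq_apply]
    simp only [Complex.sub_re, Complex.sub_im, Complex.exp_ofReal_mul_I_re,
      Complex.exp_ofReal_mul_I_im, hcos, Complex.re_ofNat, Complex.im_ofNat]
    rw [← hcos]
    nlinarith [Real.sin_sq_add_cos_sq (((σ : ℤ) : ℝ) * θ)]
  have hq := Real.cos_le_one_sub_mul_cos_sq hθ
  have hpi : 1 / 10 ≤ 1 / Real.pi ^ 2 := by
    apply one_div_le_one_div_of_le (by positivity)
    nlinarith [Real.pi_lt_d2, Real.pi_pos]
  obtain ⟨y, hy⟩ : ∃ y, y = (1 - Real.cos θ) / 2 := ⟨_, rfl⟩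
  have hy0 : 0 ≤ y := by rw [hy]; linarith [Real.cos_le_one θ]
  have hy1 : y ≤ 1 := by rw [hy]; linarith [Real.neg_one_le_cos θ]
  have hyθ : θ ^ 2 / 10 ≤ y := by
    rw [hy]
    have := mul_le_mul_of_nonneg_right hpi (sq_nonneg θ)
    have e : 2 / Real.pi ^ 2 * θ ^ 2 = 2 * (1 / Real.pi ^ 2 * θ ^ 2) := by ring
    linarith
  have hexp : Real.exp y ≤ 1 + 3 * y := by
    have := Real.abs_exp_sub_one_sub_id_le (x := y) (by rw [abs_of_nonneg hy0]; exact hy1)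
    rw [abs_le] at this; nlinarith
  have hsq : ‖geomChar θ σ‖ ^ 2 ≤ Real.exp (-(1 / 20) * θ ^ 2) ^ 2 := by
    rw [geomChar, norm_div, div_pow, hn, ← Real.exp_nat_mul]
    rw [show (10 : ℝ) - 6 * Real.cos θ = 4 * (1 + 3 * y) by rw [hy]; ring]
    norm_num
    calc (4 : ℝ) / (4 * (1 + 3 * y)) = (1 + 3 * y)⁻¹ := by field_simp
      _ ≤ (Real.exp y)⁻¹ := by gcongr
      _ = Real.exp (-y) := (Real.exp_neg y).symm
      _ ≤ _ := Real.exp_le_exp.2 (by linarith)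
  exact le_of_sq_le_sq hsq (Real.exp_pos _).le

theorem continuous_geomChar (σ : ℤˣ) : Continuous fun θ => geomChar θ σ := by
  unfold geomChar
  refine Continuous.div continuous_const (by fun_prop) fun θ => ?_
  have := three_sub_exp_ne_zero (((σ : ℤ) : ℝ) * θ)
  push_cast at this
  exact this

/-- The characteristic function of `∑ σ ξ_σ`. -/
def horizChar (l : List ℤˣ) (θ : ℝ) : ℂ := (l.map (geomChar θ)).prod

theorem continuous_horizChar (l : List ℤˣ) : Continuous (horizChar l) := by
  unfold horizChar
  induction l with
  | nil => simpa using continuous_const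
  | cons σ l ih => simpa using (continuous_geomChar σ).fun_mul ih

theorem norm_horizChar_le {θ : ℝ} (hθ : |θ| ≤ Real.pi) (l : List ℤˣ) :
    ‖horizChar l θ‖ ≤ Real.exp (-(l.length / 20) * θ ^ 2) := by
  unfold horizChar
  induction l with
  | nil => simp
  | cons σ l ih =>
    rw [List.map_cons, List.prod_cons, norm_mul]
    refine (mul_le_mul (norm_geomChar_le hθ σ) ih (norm_nonneg _) (Real.exp_pos _).le).trans ?_
    rw [← Real.exp_add, List.length_cons]
    refine (congrArg _ ?_).le
    push_cast; ring

/-- The Fourier coefficients of `horizChar`. -/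
def horizCoeff (l : List ℤˣ) (x : ℤ) : ℂ :=
  (2 * Real.pi : ℂ)⁻¹ *
    ∫ θ in (-Real.pi)..Real.pi, horizChar l θ * Complex.exp (-(x * θ * Complex.I))

theorem norm_horizCoeff_le_integral (l : List ℤˣ) (x : ℤ) :
    ‖horizCoeff l x‖ ≤
      (2 * Real.pi)⁻¹ * ∫ θ in (-Real.pi)..Real.pi, Real.exp (-(l.length / 20) * θ ^ 2) := by
  have hpi := Real.pi_pos
  rw [horizCoeff, norm_mul]
  have h1 : ‖(2 * Real.pi : ℂ)⁻¹‖ = (2 * Real.pi)⁻¹ := by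
    rw [norm_inv, norm_mul, Complex.norm_real, Real.norm_of_nonneg hpi.le]; simp
  rw [h1]
  gcongr
  refine intervalIntegral.norm_integral_le_of_norm_le (by linarith) ?_ ?_
  · refine Eventually.of_forall fun θ hθ => ?_
    have : ‖Complex.exp (-(x * θ * Complex.I))‖ = 1 := by
      rw [show -((x : ℂ) * θ * Complex.I) = ((-(x * θ) : ℝ) : ℂ) * Complex.I by push_cast; ring]
      exact Complex.norm_exp_ofReal_mul_I _
    rw [norm_mul, this, mul_one]
    exact norm_horizChar_le (abs_le.2 ⟨hθ.1.le, hθ.2⟩) l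
  · exact Continuous.intervalIntegrable (by fun_prop) _ _

theorem norm_horizCoeff_le_one (l : List ℤˣ) (x : ℤ) : ‖horizCoeff l x‖ ≤ 1 := by
  have hpi := Real.pi_pos
  refine (norm_horizCoeff_le_integral l x).trans ?_
  have : ∫ θ in (-Real.pi)..Real.pi, Real.exp (-(l.length / 20) * θ ^ 2) ≤
      ∫ _θ in (-Real.pi)..Real.pi, (1 : ℝ) := by
    refine intervalIntegral.integral_mono_on (by linarith)
      (Continuous.intervalIntegrable (by fun_prop) _ _)
      (Continuous.intervalIntegrable (by fun_prop) _ _) fun θ _ => ?_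
    rw [Real.exp_le_one_iff]
    have : 0 ≤ (l.length / 20 : ℝ) * θ ^ 2 := by positivity
    linarith
  rw [intervalIntegral.integral_const, smul_eq_mul] at this
  calc _ ≤ (2 * Real.pi)⁻¹ * ((Real.pi - -Real.pi) * 1) := by gcongr
    _ = 1 := by field_simp; ring

theorem norm_horizCoeff_le (l : List ℤˣ) (hl : l ≠ []) (x : ℤ) :
    ‖horizCoeff l x‖ ≤ 2 / √l.length := by
  have hpi := Real.pi_pos
  have hm : (0 : ℝ) < l.length := by exact_mod_cast List.length_pos_of_ne_nil hl
  refine (norm_horizCoeff_le_integral l x).trans ?_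
  have h1 : ∫ θ in (-Real.pi)..Real.pi, Real.exp (-(l.length / 20) * θ ^ 2) ≤
      √(Real.pi / (l.length / 20)) := by
    rw [← integral_gaussian, intervalIntegral.integral_of_le (by linarith)]
    exact setIntegral_le_integral (integrable_exp_neg_mul_sq (by positivity))
      (Eventually.of_forall fun _ => (Real.exp_pos _).le)
  have h2 : √(Real.pi / (l.length / 20)) ≤ 8 / √l.length := by
    rw [show (8 : ℝ) = √64 by rw [show (64 : ℝ) = 8 ^ 2 by norm_num]; simp,
      ← Real.sqrt_div (by norm_num)]
    apply Real.sqrt_le_sqrt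
    rw [div_div_eq_mul_div]
    gcongr
    linarith [Real.pi_lt_d2]
  have hs : 0 < √(l.length : ℝ) := Real.sqrt_pos.2 hm
  calc _ ≤ (2 * Real.pi)⁻¹ * (8 / √l.length) := by gcongr; exact h1.trans h2
    _ ≤ 4⁻¹ * (8 / √l.length) := by gcongr; linarith [Real.two_le_pi]
    _ = _ := by ring

theorem horizCoeff_nil (x : ℤ) : horizCoeff [] x = if x = 0 then 1 else 0 := by
  have hpi : (Real.pi : ℂ) ≠ 0 := by exact_mod_cast Real.pi_ne_zero
  unfold horizCoeff horizChar
  split_ifs with h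
  · subst h
    simp only [List.map_nil, List.prod_nil, Int.cast_zero, zero_mul, neg_zero, Complex.exp_zero,
      mul_one, intervalIntegral.integral_const, Complex.real_smul]
    push_cast
    field_simp
    ring
  · have hx : (x : ℂ) ≠ 0 := by exact_mod_cast h
    have hc : -(x * Complex.I) ≠ 0 := neg_ne_zero.2 (mul_ne_zero hx Complex.I_ne_zero)
    have := integral_exp_mul_complex (a := -Real.pi) (b := Real.pi) hc
    simp only [List.map_nil, List.prod_nil, one_mul]
    have e : ∀ θ : ℝ, -((x : ℂ) * θ * Complex.I) = -(x * Complex.I) * θ := fun θ => by ring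
    simp only [e]
    rw [this]
    have h1 : Complex.exp (-(x * Complex.I) * Real.pi) =
        Complex.exp (-(x * Complex.I) * ((-Real.pi : ℝ) : ℂ)) := by
      rw [Complex.exp_eq_exp_iff_exists_int]
      exact ⟨-x, by push_cast; ring⟩
    rw [h1, sub_self]
    simp

theorem horizCoeff_cons (σ : ℤˣ) (l : List ℤˣ) (x : ℤ) :
    3 * horizCoeff (σ :: l) x = 2 * horizCoeff l x + horizCoeff (σ :: l) (x - σ) := by
  have hI : ∀ (l : List ℤˣ) (x : ℤ), IntervalIntegrable
      (fun θ : ℝ => horizChar l θ * Complex.exp (-(x * θ * Complex.I))) volume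
      (-Real.pi) Real.pi := fun l x =>
    ((continuous_horizChar l).mul (by fun_prop)).intervalIntegrable _ _
  have key : ∀ θ : ℝ, 3 * (horizChar (σ :: l) θ * Complex.exp (-(x * θ * Complex.I))) =
      2 * (horizChar l θ * Complex.exp (-(x * θ * Complex.I))) +
      horizChar (σ :: l) θ * Complex.exp (-(((x - σ : ℤ) : ℂ) * θ * Complex.I)) := by
    intro θ
    have h3 := three_sub_exp_ne_zero (((σ : ℤ) : ℝ) * θ)
    push_cast at h3
    have e : Complex.exp (-(((x - σ : ℤ) : ℂ) * θ * Complex.I)) =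
        Complex.exp (-(x * θ * Complex.I)) * Complex.exp (((σ : ℤ) : ℂ) * θ * Complex.I) := by
      rw [← Complex.exp_add]; congr 1; push_cast; ring
    rw [e]
    simp only [horizChar, List.map_cons, List.prod_cons, geomChar]
    field_simp
    ring
  unfold horizCoeff
  have hint := intervalIntegral.integral_add ((hI l x).const_mul 2) (hI (σ :: l) (x - σ))
  simp only [← key, intervalIntegral.integral_const_mul] at hint
  rw [mul_left_comm, mul_left_comm 2, ← mul_add, hint]

theorem horizLaw_le_one (l : List ℤˣ) (x : ℤ) : horizLaw l x ≤ 1 := by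
  have := horizLaw_le_exp (s := 0) (by norm_num) l x
  simpa using this

/-- Fourier inversion by uniqueness: both sides satisfy the same first-order recursion in x, so
their difference d has ‖d x‖ = ‖d (x - σ)‖/3. Being bounded, it vanishes by iteration, and no sum is
exchanged with an integral. -/
theorem toReal_horizLaw (l : List ℤˣ) (x : ℤ) :
    ((horizLaw l x).toReal : ℂ) = horizCoeff l x := by
  induction l generalizing x with
  | nil => rw [horizCoeff_nil, horizLaw]; split_ifs <;> simp
  | cons σ l ih =>
    have htop : ∀ l x, horizLaw l x ≠ ∞ := fun l x =>
      ne_top_of_le_ne_top ENNReal.one_ne_top (horizLaw_le_one l x)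
    have hrec : ∀ x, 3 * ((horizLaw (σ :: l) x).toReal : ℂ) =
        2 * horizCoeff l x + ((horizLaw (σ :: l) (x - σ)).toReal : ℂ) := by
      intro x
      rw [← ih]
      have h := congrArg ENNReal.toReal (horizLaw_cons σ l x)
      rw [ENNReal.toReal_add (by finiteness [htop l x]) (by finiteness [htop (σ :: l) (x - σ)])] at h
      simp only [ENNReal.toReal_mul, ENNReal.toReal_inv, ENNReal.toReal_ofNat] at h
      rw [h]
      push_cast
      ring
    obtain ⟨d, hd⟩ : ∃ d : ℤ → ℂ, d = fun x =>
      ((horizLaw (σ :: l) x).toReal : ℂ) - horizCoeff (σ :: l) x := ⟨_, rfl⟩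
    have hd3 : ∀ x, ‖d x‖ = 3⁻¹ * ‖d (x - σ)‖ := by
      intro x
      have : d x = 3⁻¹ * d (x - σ) := by
        have h1 := hrec x
        have h2 := horizCoeff_cons σ l x
        rw [hd]
        linear_combination (1 / 3) * h1 - (1 / 3) * h2
      rw [this, norm_mul]; simp
    have hb : ∀ x, ‖d x‖ ≤ 2 := by
      intro x
      rw [hd]
      refine (norm_sub_le _ _).trans ?_
      have h1 : ‖((horizLaw (σ :: l) x).toReal : ℂ)‖ ≤ 1 := by
        rw [Complex.norm_real, Real.norm_of_nonneg ENNReal.toReal_nonneg]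
        exact ENNReal.toReal_mono ENNReal.one_ne_top (horizLaw_le_one _ _)
      linarith [norm_horizCoeff_le_one (σ :: l) x]
    have hit : ∀ (n : ℕ) x, ‖d x‖ ≤ 3⁻¹ ^ n * 2 := by
      intro n
      induction n with
      | zero => simpa using hb
      | succ n ihn =>
        intro x
        rw [hd3, pow_succ']
        have := ihn (x - σ)
        linarith
    have h0 : ‖d x‖ ≤ 0 := by
      have ht : Tendsto (fun n : ℕ => (3⁻¹ : ℝ) ^ n * 2) atTop (nhds (0 * 2)) :=
        (tendsto_pow_atTop_nhds_zero_of_lt_one (by norm_num) (by norm_num)).mul_const 2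
      rw [zero_mul] at ht
      exact ge_of_tendsto' ht fun n => hit n x
    have := norm_le_zero_iff.1 h0
    rw [hd] at this
    exact sub_eq_zero.1 this

theorem horizLaw_le_inv_sqrt (l : List ℤˣ) (hl : l ≠ []) (x : ℤ) :
    horizLaw l x ≤ ENNReal.ofReal (2 / √l.length) := by
  rw [← ENNReal.ofReal_toReal
    (ne_top_of_le_ne_top ENNReal.one_ne_top (horizLaw_le_one l x))]
  refine ENNReal.ofReal_le_ofReal ?_
  have := norm_horizCoeff_le l hl x
  rw [← toReal_horizLaw, Complex.norm_real] at this
  exact (le_abs_self _).trans this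

/-! ### Estimates for the vertical walk -/

/-- The probability that a simple random walk goes from `y` to `z` in `m` steps. -/
def hitProb (m : ℕ) (y z : ℤ) : ℝ≥0∞ :=
  pathAvg m y fun l => if l.getLast? = some z then 1 else 0

theorem hitProb_zero (y z : ℤ) : hitProb 0 y z = if y = z then 1 else 0 := by
  simp [hitProb, pathAvg]

theorem hitProb_succ (m : ℕ) (y z : ℤ) :
    hitProb (m + 1) y z = 2⁻¹ * (hitProb m (y + 1) z + hitProb m (y - 1) z) := by
  have hlast : ∀ l : List ℤ, l.length = m + 1 → (y :: l).getLast? = l.getLast? := by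
    intro l hl
    cases l with
    | nil => simp at hl
    | cons a l => simp
  simp only [hitProb, pathAvg]
  congr 2 <;> exact pathAvg_congr fun l hl => by rw [hlast l hl]

theorem two_inv_mul_add_self (a : ℝ≥0∞) : 2⁻¹ * (a + a) = a := by
  rw [← two_mul, ← mul_assoc, ENNReal.inv_mul_cancel (by simp) (by simp), one_mul]

/-- Here j counts the upward steps; values j > m need no exclusion since the binomial coefficient is
then zero. -/
theorem hitProb_eq (m : ℕ) (y z : ℤ) :
    (∀ j : ℕ, z - y = 2 * j - m → hitProb m y z = 2⁻¹ ^ m * (m.choose j : ℝ≥0∞)) ∧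
    ((∀ j : ℕ, z - y ≠ 2 * j - m) → hitProb m y z = 0) := by
  induction m generalizing y with
  | zero =>
    rw [hitProb_zero]
    constructor
    · intro j hj
      rcases Nat.eq_zero_or_pos j with rfl | h
      · have : y = z := by push_cast at hj; omega
        simp [this]
      · have : y ≠ z := by push_cast at hj; omega
        simp [this, Nat.choose_eq_zero_of_lt h]
    · intro h
      have := h 0
      have : y ≠ z := by push_cast at this; omega
      simp [this]
  | succ m ih =>
    rw [hitProb_succ]
    constructor
    · intro j hj
      have hd : hitProb m (y - 1) z = 2⁻¹ ^ m * (m.choose j : ℝ≥0∞) :=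
        (ih (y - 1)).1 j (by push_cast at hj; omega)
      rw [hd]
      cases j with
      | zero =>
        have : hitProb m (y + 1) z = 0 := (ih (y + 1)).2 fun j => by push_cast at hj; omega
        rw [this]
        simp [pow_succ']
      | succ j =>
        have : hitProb m (y + 1) z = 2⁻¹ ^ m * (m.choose j : ℝ≥0∞) :=
          (ih (y + 1)).1 j (by push_cast at hj; omega)
        rw [this, Nat.choose_succ_succ]
        push_cast
        ring
    · intro h
      rw [(ih (y + 1)).2 fun j => by have := h (j + 1); push_cast at this; omega,
        (ih (y - 1)).2 fun j => by have := h j; push_cast at this; omega]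
      simp

/-- The factor 2n + 1 makes the induction close, through (2n + 1)(2n + 3) ≤ 4(n + 1)². It also gives
a bound at time 2n that serves unchanged at time 2n + 1 in `hitProb_le`. -/
theorem centralBinom_sq_le (n : ℕ) : (2 * n + 1) * n.centralBinom ^ 2 ≤ 16 ^ n := by
  induction n with
  | zero => simp
  | succ n ih =>
    have h := Nat.succ_mul_centralBinom_succ n
    have h2 : (n + 1) ^ 2 * ((2 * (n + 1) + 1) * (n + 1).centralBinom ^ 2) ≤
        (n + 1) ^ 2 * 16 ^ (n + 1) := by
      calc (n + 1) ^ 2 * ((2 * (n + 1) + 1) * (n + 1).centralBinom ^ 2)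
          = (2 * n + 3) * ((n + 1) * (n + 1).centralBinom) ^ 2 := by ring
        _ = 4 * ((2 * n + 3) * (2 * n + 1)) * ((2 * n + 1) * n.centralBinom ^ 2) := by
            rw [h]; ring
        _ ≤ 4 * (4 * (n + 1) ^ 2) * 16 ^ n :=
            Nat.mul_le_mul (Nat.mul_le_mul_left 4 (by nlinarith)) ih
        _ = _ := by ring
    exact Nat.le_of_mul_le_mul_left h2 (by positivity)

theorem hitProb_two_mul_le (n : ℕ) (y z : ℤ) :
    hitProb (2 * n) y z ≤ ENNReal.ofReal (1 / √(2 * n + 1)) := by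
  by_cases h : ∃ j : ℕ, z - y = 2 * j - (2 * n : ℕ)
  · obtain ⟨j, hj⟩ := h
    rw [(hitProb_eq _ y z).1 j hj]
    have h1 : (((2 * n).choose j : ℕ) : ℝ) ≤ n.centralBinom := by
      exact_mod_cast Nat.choose_le_centralBinom j n
    have h2 : ((n.centralBinom : ℕ) : ℝ) ≤ 4 ^ n / √(2 * n + 1) := by
      rw [le_div_iff₀ (by positivity)]
      refine le_of_sq_le_sq ?_ (by positivity)
      rw [mul_pow, Real.sq_sqrt (by positivity), ← pow_mul, mul_comm n, pow_mul]
      have := centralBinom_sq_le n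
      have h3 : ((2 * n + 1) * n.centralBinom ^ 2 : ℝ) ≤ 16 ^ n := by exact_mod_cast this
      norm_num
      linarith
    rw [← ENNReal.ofReal_natCast, ← ENNReal.ofReal_ofNat 2,
      ← ENNReal.ofReal_inv_of_pos (by norm_num), ← ENNReal.ofReal_pow (by norm_num),
      ← ENNReal.ofReal_mul (by positivity)]
    refine ENNReal.ofReal_le_ofReal ?_
    calc (2⁻¹ : ℝ) ^ (2 * n) * ((2 * n).choose j : ℕ)
        ≤ (4 ^ n)⁻¹ * (4 ^ n / √(2 * n + 1)) := by
          rw [pow_mul, ← inv_pow, show ((2 : ℝ)⁻¹ ^ 2) = 4⁻¹ by norm_num]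
          exact mul_le_mul_of_nonneg_left (h1.trans h2) (by positivity)
      _ = _ := by field_simp
  · push Not at h
    rw [(hitProb_eq _ y z).2 h]
    simp

theorem hitProb_le {m : ℕ} (y z : ℤ) :
    hitProb m y z ≤ ENNReal.ofReal (1 / √m) ∨ m = 0 := by
  rcases Nat.even_or_odd' m with ⟨n, rfl | rfl⟩
  · rcases Nat.eq_zero_or_pos n with rfl | hn
    · simp
    · left
      refine (hitProb_two_mul_le n y z).trans (ENNReal.ofReal_le_ofReal ?_)
      have : (0 : ℝ) < n := by exact_mod_cast hn
      gcongr
      push_cast; linarith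
  · left
    rw [hitProb_succ]
    calc _ ≤ 2⁻¹ * (ENNReal.ofReal (1 / √(2 * n + 1)) + ENNReal.ofReal (1 / √(2 * n + 1))) := by
          gcongr <;> exact hitProb_two_mul_le n _ _
      _ = _ := by rw [two_inv_mul_add_self]; push_cast; rfl

theorem sum_inv_sqrt_le (m : ℕ) : ∑ k ∈ Finset.range m, 1 / √((k : ℝ) + 1) ≤ 2 * √m := by
  induction m with
  | zero => simp
  | succ m ih =>
    rw [Finset.sum_range_succ]
    have h1 : 0 < √((m : ℝ) + 1) := Real.sqrt_pos.2 (by positivity)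
    have h2 : √((m : ℝ) + 1) ^ 2 = m + 1 := Real.sq_sqrt (by positivity)
    have h3 : √(m : ℝ) ^ 2 = m := Real.sq_sqrt (by positivity)
    have h4 : 1 / √((m : ℝ) + 1) ≤ 2 * (√((m : ℝ) + 1) - √m) := by
      rw [div_le_iff₀ h1]
      nlinarith [sq_nonneg (√((m : ℝ) + 1) - √m)]
    push_cast
    linarith

theorem sum_hitProb_le (m : ℕ) (y z : ℤ) :
    ∑ k ∈ Finset.range (m + 1), hitProb k y z ≤ ENNReal.ofReal (1 + 2 * √m) := by
  rw [Finset.sum_range_succ', add_comm, ENNReal.ofReal_add (by norm_num) (by positivity)]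
  gcongr
  · rw [hitProb_zero]; split_ifs <;> simp
  · refine le_trans ?_ (ENNReal.ofReal_le_ofReal (sum_inv_sqrt_le m))
    rw [ENNReal.ofReal_sum_of_nonneg fun _ _ => by positivity]
    refine Finset.sum_le_sum fun k _ => ?_
    simpa using hitProb_le (m := k + 1) y z

/-- Khas'minskii's bound for the exponential moments of a local time. -/
theorem pathAvg_pow_count_le {M : ℕ} {lam : ℝ≥0∞} (hlam : lam * ENNReal.ofReal (1 + 2 * √M) ≤ 2⁻¹)
    (z : ℤ) {m : ℕ} (hm : m ≤ M) (y : ℤ) :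
    pathAvg m y (fun l => (1 + lam) ^ l.count z) ≤ 2 := by
  have h1 : ∀ m ≤ M, ∀ y, 1 + lam * 2 * ∑ k ∈ Finset.range (m + 1), hitProb k y z ≤ 2 := by
    intro m hm y
    have h2 : ∑ k ∈ Finset.range (m + 1), hitProb k y z ≤ ENNReal.ofReal (1 + 2 * √M) :=
      (sum_hitProb_le m y z).trans (ENNReal.ofReal_le_ofReal (by gcongr))
    calc 1 + lam * 2 * ∑ k ∈ Finset.range (m + 1), hitProb k y z
        ≤ 1 + 2 * (lam * ENNReal.ofReal (1 + 2 * √M)) := by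
          rw [mul_comm lam, mul_assoc]; gcongr
      _ ≤ 1 + 2 * 2⁻¹ := by gcongr
      _ = 2 := by rw [ENNReal.mul_inv_cancel (by simp) (by simp)]; norm_num
  -- The induction carries a sharper bound, linear in the expected local time at z; the constant 2
  -- is recovered from it by `h1`.
  refine le_trans ?_ (h1 m hm y)
  induction m generalizing y with
  | zero =>
    by_cases h : y = z <;> simp [pathAvg, hitProb_zero, h]
    exact le_mul_of_one_le_right zero_le (by norm_num)
  | succ m ih =>
    have ih' := ih (by omega)
    have hle : ∀ y, pathAvg m y (fun l => (1 + lam) ^ l.count z) ≤ 2 := fun y =>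
      (ih' y).trans (h1 m (by omega) y)
    rw [Finset.sum_range_succ']
    simp only [hitProb_succ, hitProb_zero, ← Finset.mul_sum, Finset.sum_add_distrib]
    set A := ∑ k ∈ Finset.range (m + 1), hitProb k (y + 1) z
    set B := ∑ k ∈ Finset.range (m + 1), hitProb k (y - 1) z
    set w := fun y => pathAvg m y (fun l => (1 + lam) ^ l.count z)
    have hw : 2⁻¹ * (w (y + 1) + w (y - 1)) ≤ 1 + lam * 2 * (2⁻¹ * (A + B)) := by
      calc _ ≤ 2⁻¹ * ((1 + lam * 2 * A) + (1 + lam * 2 * B)) := by gcongr <;> exact ih' _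
        _ = 2⁻¹ * (1 + 1) + lam * 2 * (2⁻¹ * (A + B)) := by ring
        _ = _ := by rw [two_inv_mul_add_self]
    have hw2 : 2⁻¹ * (w (y + 1) + w (y - 1)) ≤ 2 := by
      calc _ ≤ 2⁻¹ * (2 + 2 : ℝ≥0∞) := by gcongr <;> exact hle _
        _ = _ := two_inv_mul_add_self 2
    by_cases h : y = z
    · simp only [pathAvg, h, List.count_cons_self, pow_succ', pathAvg_const_mul, if_true]
      subst h
      -- A visit to z multiplies by 1 + lam: the term without lam uses the sharp bound, the term
      -- with lam only the crude bound 2, which matches the new summand of the local time.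
      calc _ = 2⁻¹ * (w (y + 1) + w (y - 1)) + lam * (2⁻¹ * (w (y + 1) + w (y - 1))) := by ring
        _ ≤ (1 + lam * 2 * (2⁻¹ * (A + B))) + lam * 2 := by gcongr
        _ = _ := by ring
    · simp only [pathAvg, List.count_cons_of_ne h, if_neg h, add_zero]
      exact hw

/-- Position k contributes cosh(lam)^k e^(lam y), and cosh ≥ 1 bounds all powers by the last. The
sum over positions dominates the maximum, so this replaces a maximal inequality. -/
theorem pathAvg_sum_exp_le (m : ℕ) (y : ℤ) (lam : ℝ) :
    pathAvg m y (fun l => (l.map fun z : ℤ => ENNReal.ofReal (Real.exp (lam * z))).sum) ≤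
      (m + 1) * ENNReal.ofReal (Real.cosh lam) ^ m * ENNReal.ofReal (Real.exp (lam * y)) := by
  have hstep : ∀ y : ℤ, 2⁻¹ * (ENNReal.ofReal (Real.exp (lam * (y + 1 : ℤ))) +
      ENNReal.ofReal (Real.exp (lam * (y - 1 : ℤ)))) =
      ENNReal.ofReal (Real.cosh lam) * ENNReal.ofReal (Real.exp (lam * y)) := by
    intro y
    rw [← ENNReal.ofReal_add (by positivity) (by positivity), ← ENNReal.ofReal_ofNat 2,
      ← ENNReal.ofReal_inv_of_pos (by norm_num), ← ENNReal.ofReal_mul (by norm_num),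
      ← ENNReal.ofReal_mul (Real.cosh_pos _).le]
    congr 1
    have e1 : Real.exp (lam * (y + 1 : ℤ)) = Real.exp (lam * y) * Real.exp lam := by
      rw [← Real.exp_add]; push_cast; ring_nf
    have e2 : Real.exp (lam * (y - 1 : ℤ)) = Real.exp (lam * y) * Real.exp (-lam) := by
      rw [← Real.exp_add]; push_cast; ring_nf
    rw [Real.cosh_eq, e1, e2]
    simp only [OfNat.ofNat]
    ring
  have hc : 1 ≤ ENNReal.ofReal (Real.cosh lam) := by
    rw [ENNReal.one_le_ofReal]; exact Real.one_le_cosh lam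
  induction m generalizing y with
  | zero => simp [pathAvg]
  | succ m ih =>
    simp only [pathAvg, List.map_cons, List.sum_cons, pathAvg_add, pathAvg_const]
    set c := ENNReal.ofReal (Real.cosh lam)
    set E := fun y : ℤ => ENNReal.ofReal (Real.exp (lam * y))
    calc _ = 2⁻¹ * (E y + E y) + 2⁻¹ *
          (pathAvg m (y + 1) (fun l => (l.map fun z : ℤ => E z).sum) +
          pathAvg m (y - 1) (fun l => (l.map fun z : ℤ => E z).sum)) := by ring
      _ ≤ E y + 2⁻¹ * ((m + 1) * c ^ m * E (y + 1) + (m + 1) * c ^ m * E (y - 1)) := by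
          rw [two_inv_mul_add_self]
          gcongr <;> exact ih _
      _ = E y + (m + 1) * c ^ m * (2⁻¹ * (E (y + 1) + E (y - 1))) := by ring
      _ = 1 * E y + (m + 1) * c ^ (m + 1) * E y := by rw [hstep]; ring
      _ ≤ c ^ (m + 1) * E y + (m + 1) * c ^ (m + 1) * E y := by
          gcongr; exact one_le_pow₀ hc
      _ = _ := by push_cast; ring

/-! ### Associated fields of signs: Newman's inequality -/

instance : DiscreteMeasurableSpace ℤˣ :=
  ⟨fun s => ⟨Units.val '' s, trivial, Set.preimage_image_eq s Units.val_injective⟩⟩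

theorem measurable_of_dependsOn {β : Type*} [MeasurableSpace β] [Nonempty β]
    {F : (ℤ → ℤˣ) → β} {s : Finset ℤ} (hF : DependsOn F s) : Measurable F := by
  obtain ⟨g, rfl⟩ := dependsOn_iff_exists_comp.1 hF
  have hg : Measurable g := measurable_of_countable g
  exact hg.comp (by fun_prop)

theorem exists_norm_le_of_dependsOn {E : Type*} [NormedAddCommGroup E] {F : (ℤ → ℤˣ) → E}
    {s : Finset ℤ} (hF : DependsOn F s) : ∃ C, ∀ e, ‖F e‖ ≤ C := by
  obtain ⟨g, rfl⟩ := dependsOn_iff_exists_comp.1 hF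
  obtain ⟨C, hC⟩ := (Set.finite_range fun x => ‖g x‖).bddAbove
  exact ⟨C, fun e => hC ⟨_, rfl⟩⟩

theorem memLp_of_dependsOn {ν : Measure (ℤ → ℤˣ)} [IsProbabilityMeasure ν] {p : ℝ≥0∞}
    {F : (ℤ → ℤˣ) → ℝ} {s : Finset ℤ} (hF : DependsOn F s) : MemLp F p ν := by
  obtain ⟨C, hC⟩ := exists_norm_le_of_dependsOn hF
  exact MemLp.of_bound (measurable_of_dependsOn hF).aestronglyMeasurable C
    (Eventually.of_forall hC)

theorem integrable_of_dependsOn {ν : Measure (ℤ → ℤˣ)} [IsProbabilityMeasure ν]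
    {F : (ℤ → ℤˣ) → ℝ} {s : Finset ℤ} (hF : DependsOn F s) : Integrable F ν :=
  memLp_one_iff_integrable.1 (memLp_of_dependsOn hF)

theorem integrable_complex_of_dependsOn {ν : Measure (ℤ → ℤˣ)} [IsProbabilityMeasure ν]
    {F : (ℤ → ℤˣ) → ℂ} {s : Finset ℤ} (hF : DependsOn F s) : Integrable F ν := by
  obtain ⟨C, hC⟩ := exists_norm_le_of_dependsOn hF
  exact memLp_one_iff_integrable.1 (MemLp.of_bound
    (measurable_of_dependsOn hF).aestronglyMeasurable C (Eventually.of_forall hC))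

/-- Monotone functions of finitely many coordinates are positively correlated under `ν`. -/
def PositivelyCorrelated (ν : Measure (ℤ → ℤˣ)) : Prop :=
  ∀ (s : Finset ℤ) (F G : (ℤ → ℤˣ) → ℝ), DependsOn F s → DependsOn G s →
    Monotone F → Monotone G → 0 ≤ cov[F, G; ν]

/-- The linear statistic `∑ a y * e y` over `y ∈ s`. -/
def linSum (s : Finset ℤ) (a : ℤ → ℝ) (e : ℤ → ℤˣ) : ℝ :=
  ∑ y ∈ s, a y * ((e y : ℤ) : ℝ)

/-- The covariance of the signs at `y` and `z`. -/
def pairCov (ν : Measure (ℤ → ℤˣ)) (y z : ℤ) : ℝ :=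
  cov[fun e => ((e y : ℤ) : ℝ), fun e => ((e z : ℤ) : ℝ); ν]

theorem dependsOn_coord (y : ℤ) {s : Finset ℤ} (hy : y ∈ s) :
    DependsOn (fun e : ℤ → ℤˣ => ((e y : ℤ) : ℝ)) s := fun e e' h => by
  simp [h y hy]

theorem dependsOn_linSum {s t : Finset ℤ} (h : s ⊆ t) (a : ℤ → ℝ) :
    DependsOn (linSum s a) t := fun e e' he =>
  Finset.sum_congr rfl fun y hy => by rw [he y (h hy)]

theorem dependsOn_comp {β γ : Type*} {F : (ℤ → ℤˣ) → β} {s : Finset ℤ} (hF : DependsOn F s)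
    (f : β → γ) : DependsOn (fun e => f (F e)) s := fun _ _ h => congrArg f (hF h)

theorem dependsOn_comp₂ {β γ δ : Type*} {F : (ℤ → ℤˣ) → β} {G : (ℤ → ℤˣ) → γ} {s : Finset ℤ}
    (hF : DependsOn F s) (hG : DependsOn G s) (f : β → γ → δ) :
    DependsOn (fun e => f (F e) (G e)) s := fun _ _ h => congrArg₂ f (hF h) (hG h)

theorem monotone_coord (y : ℤ) : Monotone fun e : ℤ → ℤˣ => ((e y : ℤ) : ℝ) := fun _ _ h =>
  Int.cast_le.2 (Units.val_le_val.2 (h y))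

theorem monotone_linSum (s : Finset ℤ) {a : ℤ → ℝ} (ha : ∀ y, 0 ≤ a y) :
    Monotone (linSum s a) := fun _ _ h =>
  Finset.sum_le_sum fun y _ => mul_le_mul_of_nonneg_left (monotone_coord y h) (ha y)

theorem pairCov_nonneg {ν : Measure (ℤ → ℤˣ)} (hν : PositivelyCorrelated ν) (y z : ℤ) : 0 ≤ pairCov ν y z :=
  hν {y, z} _ _ (dependsOn_coord y (by simp)) (dependsOn_coord z (by simp)) (monotone_coord y)
    (monotone_coord z)

section

variable {ν : Measure (ℤ → ℤˣ)} [IsProbabilityMeasure ν]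

theorem cov_linSum (s t : Finset ℤ) (a b : ℤ → ℝ) :
    cov[linSum s a, linSum t b; ν] = ∑ y ∈ s, ∑ z ∈ t, a y * b z * pairCov ν y z := by
  have hm : ∀ (a : ℤ → ℝ) y, MemLp (fun e : ℤ → ℤˣ => a y * ((e y : ℤ) : ℝ)) 2 ν := fun a y =>
    memLp_of_dependsOn (dependsOn_comp (dependsOn_coord y (Finset.mem_singleton_self y))
      fun x => a y * x)
  have := covariance_fun_sum_fun_sum' (μ := ν) (s := s) (t := t) (fun i _ => hm a i)
    (fun i _ => hm b i)
  unfold linSum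
  rw [this]
  refine Finset.sum_congr rfl fun y _ => Finset.sum_congr rfl fun z _ => ?_
  rw [covariance_const_mul_left, covariance_const_mul_right, pairCov]
  ring

/-- For f 1-Lipschitz and U monotone, both U + f(U) and U - f(U) are monotone. Adding in pairs the
four resulting nonnegative covariances gives the two inequalities. -/
theorem abs_cov_lipschitz_le (hν : PositivelyCorrelated ν) {s : Finset ℤ}
    {U V : (ℤ → ℤˣ) → ℝ} (hU : DependsOn U s) (hV : DependsOn V s) (hUm : Monotone U)
    (hVm : Monotone V) {f g : ℝ → ℝ} (hf : LipschitzWith 1 f) (hg : LipschitzWith 1 g) :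
    |cov[fun e => f (U e), fun e => g (V e); ν]| ≤ cov[U, V; ν] := by
  have hmono : ∀ {U : (ℤ → ℤˣ) → ℝ} {f : ℝ → ℝ}, Monotone U → LipschitzWith 1 f →
      Monotone (U + fun e => f (U e)) ∧ Monotone (U - fun e => f (U e)) := by
    intro U f hU hf
    have key : ∀ x y, x ≤ y → |f x - f y| ≤ y - x := by
      intro x y hxy
      have := hf.dist_le_mul x y
      simpa [Real.dist_eq, abs_of_nonpos (sub_nonpos.2 hxy)] using this
    constructor <;> intro e e' h <;> have h1 := abs_le.1 (key _ _ (hU h)) <;>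
      simp only [Pi.add_apply, Pi.sub_apply] <;> linarith
  have fU := dependsOn_comp hU f
  have gV := dependsOn_comp hV g
  have mU : MemLp U 2 ν := memLp_of_dependsOn hU
  have mV : MemLp V 2 ν := memLp_of_dependsOn hV
  have mfU : MemLp (fun e => f (U e)) 2 ν := memLp_of_dependsOn fU
  have mgV : MemLp (fun e => g (V e)) 2 ν := memLp_of_dependsOn gV
  have dUa : DependsOn (U + fun e => f (U e)) s := dependsOn_comp hU fun x => x + f x
  have dUs : DependsOn (U - fun e => f (U e)) s := dependsOn_comp hU fun x => x - f x
  have dVa : DependsOn (V + fun e => g (V e)) s := dependsOn_comp hV fun x => x + g x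
  have dVs : DependsOn (V - fun e => g (V e)) s := dependsOn_comp hV fun x => x - g x
  obtain ⟨U1, U2⟩ := hmono hUm hf
  obtain ⟨V1, V2⟩ := hmono hVm hg
  have h1 := hν s _ _ dUa dVa U1 V1
  have h2 := hν s _ _ dUs dVs U2 V2
  have h3 := hν s _ _ dUa dVs U1 V2
  have h4 := hν s _ _ dUs dVa U2 V1
  rw [covariance_add_left mU mfU (mV.add mgV), covariance_add_right mU mV mgV,
    covariance_add_right mfU mV mgV] at h1
  rw [covariance_sub_left mU mfU (mV.sub mgV), covariance_sub_right mU mV mgV,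
    covariance_sub_right mfU mV mgV] at h2
  rw [covariance_add_left mU mfU (mV.sub mgV), covariance_sub_right mU mV mgV,
    covariance_sub_right mfU mV mgV] at h3
  rw [covariance_sub_left mU mfU (mV.add mgV), covariance_add_right mU mV mgV,
    covariance_add_right mfU mV mgV] at h4
  rw [abs_le]
  constructor <;> linarith

/-- The characteristic function at `1` of a statistic of the field. -/
def charAt (ν : Measure (ℤ → ℤˣ)) (U : (ℤ → ℤˣ) → ℝ) : ℂ :=
  ∫ e, Complex.exp (U e * Complex.I) ∂ν

theorem charAt_eq {s : Finset ℤ} {U : (ℤ → ℤˣ) → ℝ} (hU : DependsOn U s) :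
    charAt ν U = (∫ e, Real.cos (U e) ∂ν : ℝ) + (∫ e, Real.sin (U e) ∂ν : ℝ) * Complex.I := by
  have h1 : Integrable (fun e => Real.cos (U e)) ν := integrable_of_dependsOn (dependsOn_comp hU _)
  have h2 : Integrable (fun e => Real.sin (U e)) ν := integrable_of_dependsOn (dependsOn_comp hU _)
  rw [← integral_complex_ofReal, ← integral_complex_ofReal, ← integral_mul_const, charAt,
    ← integral_add h1.ofReal (h2.ofReal.mul_const _)]
  refine integral_congr_ae (Eventually.of_forall fun e => ?_)
  simp [Complex.exp_mul_I]

theorem norm_charAt_le_one (U : (ℤ → ℤˣ) → ℝ) : ‖charAt ν U‖ ≤ 1 := by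
  refine (norm_integral_le_of_norm_le_const (C := 1) (Eventually.of_forall fun e => ?_)).trans ?_
  · rw [Complex.norm_exp_ofReal_mul_I]
  · simp

/-- The addition formulas split the difference into four covariances of sines and cosines, all
1-Lipschitz; hence the factor 4. -/
theorem norm_charAt_add_sub_le (hν : PositivelyCorrelated ν) {s : Finset ℤ}
    {U V : (ℤ → ℤˣ) → ℝ} (hU : DependsOn U s) (hV : DependsOn V s) (hUm : Monotone U)
    (hVm : Monotone V) :
    ‖charAt ν (fun e => U e + V e) - charAt ν U * charAt ν V‖ ≤ 4 * cov[U, V; ν] := by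
  have hs : LipschitzWith 1 Real.sin := Real.lipschitzWith_sin
  have hc : LipschitzWith 1 Real.cos := Real.lipschitzWith_cos
  have hcov : ∀ {f g : ℝ → ℝ}, LipschitzWith 1 f → LipschitzWith 1 g →
      |∫ e, f (U e) * g (V e) ∂ν - (∫ e, f (U e) ∂ν) * ∫ e, g (V e) ∂ν| ≤ cov[U, V; ν] := by
    intro f g hf hg
    have := abs_cov_lipschitz_le hν hU hV hUm hVm hf hg
    rwa [covariance_eq_sub (memLp_of_dependsOn (dependsOn_comp hU f))
      (memLp_of_dependsOn (dependsOn_comp hV g))] at this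
  have hi : ∀ f g : ℝ → ℝ, Integrable (fun e => f (U e) * g (V e)) ν := fun f g =>
    integrable_of_dependsOn (dependsOn_comp₂ hU hV fun x y => f x * g y)
  rw [charAt_eq hU, charAt_eq hV, charAt_eq (dependsOn_comp₂ hU hV fun x y => x + y)]
  simp only [Real.cos_add, Real.sin_add]
  rw [integral_sub (hi _ _) (hi _ _), integral_add (hi _ _) (hi _ _)]
  have h1 := hcov hc hc
  have h2 := hcov hs hs
  have h3 := hcov hs hc
  have h4 := hcov hc hs
  generalize ∫ e, Real.cos (U e) * Real.cos (V e) ∂ν = a1 at *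
  generalize ∫ e, Real.sin (U e) * Real.sin (V e) ∂ν = a2 at *
  generalize ∫ e, Real.sin (U e) * Real.cos (V e) ∂ν = a3 at *
  generalize ∫ e, Real.cos (U e) * Real.sin (V e) ∂ν = a4 at *
  generalize ∫ e, Real.cos (U e) ∂ν = cU at *
  generalize ∫ e, Real.cos (V e) ∂ν = cV at *
  generalize ∫ e, Real.sin (U e) ∂ν = sU at *
  generalize ∫ e, Real.sin (V e) ∂ν = sV at *
  refine (Complex.norm_le_abs_re_add_abs_im _).trans ?_
  have hre : (((a1 - a2 : ℝ) : ℂ) + ((a3 + a4 : ℝ) : ℂ) * Complex.I -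
      (cU + sU * Complex.I) * (cV + sV * Complex.I)).re = (a1 - cU * cV) - (a2 - sU * sV) := by
    simp; ring
  have him : (((a1 - a2 : ℝ) : ℂ) + ((a3 + a4 : ℝ) : ℂ) * Complex.I -
      (cU + sU * Complex.I) * (cV + sV * Complex.I)).im = (a3 - sU * cV) + (a4 - cU * sV) := by
    simp; ring
  rw [hre, him]
  have := abs_sub (a1 - cU * cV) (a2 - sU * sV)
  have := abs_add_le (a3 - sU * cV) (a4 - cU * sV)
  linarith

/-- The covariance between different blocks of a linear statistic. -/
def crossCov (ν : Measure (ℤ → ℤˣ)) (s : Finset ℤ) (a : ℤ → ℝ) (blk : ℤ → ℤ) : ℝ :=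
  ∑ y ∈ s, ∑ z ∈ s, if blk y ≠ blk z then a y * a z * pairCov ν y z else 0

theorem linSum_insert_block (s : Finset ℤ) (a : ℤ → ℝ) (blk : ℤ → ℤ) {b : ℤ} {T : Finset ℤ}
    (hb : b ∉ T) (e : ℤ → ℤˣ) :
    linSum (s.filter fun y => blk y ∈ insert b T) a e =
      linSum (s.filter fun y => blk y = b) a e + linSum (s.filter fun y => blk y ∈ T) a e := by
  unfold linSum
  simp only [Finset.sum_filter, ← Finset.sum_add_distrib]
  refine Finset.sum_congr rfl fun y _ => ?_
  by_cases h1 : blk y = b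
  · simp [h1, hb]
  · simp [h1]

/-- Newman's inequality: blocks are split off one at a time, and the errors add up because all other
factors have modulus at most 1. -/
theorem norm_charAt_sub_prod_le (hν : PositivelyCorrelated ν) (s : Finset ℤ) {a : ℤ → ℝ}
    (ha : ∀ y, 0 ≤ a y) (blk : ℤ → ℤ) (T : Finset ℤ) :
    ‖charAt ν (linSum (s.filter fun y => blk y ∈ T) a) -
      ∏ b ∈ T, charAt ν (linSum (s.filter fun y => blk y = b) a)‖ ≤
      4 * crossCov ν (s.filter fun y => blk y ∈ T) a blk := by
  induction T using Finset.induction_on with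
  | empty =>
    have : charAt ν (linSum ∅ a) = 1 := by simp [charAt, linSum]
    simp [crossCov, this]
  | insert b T hb ih =>
    have hN := norm_charAt_add_sub_le hν
      (dependsOn_linSum (Finset.filter_subset (fun y => blk y = b) s) a)
      (dependsOn_linSum (Finset.filter_subset (fun y => blk y ∈ T) s) a)
      (monotone_linSum _ ha) (monotone_linSum _ ha)
    rw [cov_linSum] at hN
    have hfun : linSum (s.filter fun y => blk y ∈ insert b T) a = fun e =>
        linSum (s.filter fun y => blk y = b) a e + linSum (s.filter fun y => blk y ∈ T) a e :=
      funext (linSum_insert_block s a blk hb)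
    rw [Finset.prod_insert hb, hfun]
    -- `crossCov` counts ordered pairs; only those with first entry in the new block are needed, and
    -- the reversed ones are dropped as nonnegative.
    have hcross : ∑ y ∈ s with blk y = b, ∑ z ∈ s with blk z ∈ T, a y * a z * pairCov ν y z +
        crossCov ν (s.filter fun y => blk y ∈ T) a blk ≤
        crossCov ν (s.filter fun y => blk y ∈ insert b T) a blk := by
      unfold crossCov
      simp only [Finset.sum_filter]
      rw [← Finset.sum_add_distrib]
      refine Finset.sum_le_sum fun y _ => ?_
      by_cases h1 : blk y = b
      · have h2 : blk y ∉ T := h1 ▸ hb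
        simp only [h1, hb, if_true, if_false, add_zero, Finset.mem_insert_self]
        refine Finset.sum_le_sum fun z _ => ?_
        have hp : 0 ≤ a y * a z * pairCov ν y z :=
          mul_nonneg (mul_nonneg (ha y) (ha z)) (pairCov_nonneg hν y z)
        by_cases h3 : blk z ∈ T
        · have h4 : b ≠ blk z := fun h => hb (h ▸ h3)
          simp [h3, h4]
        · simp only [h3, if_false]
          split_ifs <;> first | exact le_rfl | exact hp
      · simp only [h1, if_false, zero_add, Finset.mem_insert, false_or]
        split_ifs with h2
        · refine Finset.sum_le_sum fun z _ => ?_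
          have hp : 0 ≤ a y * a z * pairCov ν y z :=
            mul_nonneg (mul_nonneg (ha y) (ha z)) (pairCov_nonneg hν y z)
          by_cases h3 : blk z ∈ T
          · simp [h3]
          · simp only [h3, if_false]
            split_ifs <;> first | exact le_rfl | exact hp
        · exact le_rfl
    set A := charAt ν fun e =>
        linSum (s.filter fun y => blk y = b) a e + linSum (s.filter fun y => blk y ∈ T) a e
    set B := charAt ν (linSum (s.filter fun y => blk y = b) a)
    set C := charAt ν (linSum (s.filter fun y => blk y ∈ T) a)
    set D := ∏ b ∈ T, charAt ν (linSum (s.filter fun y => blk y = b) a)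
    calc ‖A - B * D‖ = ‖(A - B * C) + B * (C - D)‖ := by ring_nf
      _ ≤ ‖A - B * C‖ + ‖B‖ * ‖C - D‖ := (norm_add_le _ _).trans (by rw [norm_mul])
      _ ≤ ‖A - B * C‖ + 1 * ‖C - D‖ := by gcongr; exact norm_charAt_le_one _
      _ ≤ _ := by linarith

/-- Second-order Taylor expansion with remainder (2/9)|U|³ ≤ (2/9)U²: the modulus is at most 1 -
(1/2 - 2/9)W, where W is the second moment, and 1/2 - 2/9 > 1/4. -/
theorem norm_charAt_le_exp {s : Finset ℤ} {U : (ℤ → ℤˣ) → ℝ} (hU : DependsOn U s)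
    (h0 : ∫ e, U e ∂ν = 0) (h1 : ∀ e, |U e| ≤ 1) :
    ‖charAt ν U‖ ≤ Real.exp (-(∫ e, U e ^ 2 ∂ν) / 4) := by
  set W := ∫ e, U e ^ 2 ∂ν with hW
  have hi1 : Integrable U ν := integrable_of_dependsOn hU
  have hi2 : Integrable (fun e => U e ^ 2) ν := integrable_of_dependsOn (dependsOn_comp hU (· ^ 2))
  have hW0 : 0 ≤ W := integral_nonneg fun e => sq_nonneg _
  have hW1 : W ≤ 1 := by
    have := integral_mono hi2 (integrable_const (1 : ℝ)) (fun e => (sq_le_one_iff_abs_le_one _).2 (h1 e))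
    simpa using this
  have hpt : ∀ e, ‖Complex.exp (U e * Complex.I) - ((1 : ℂ) + U e * Complex.I - (U e ^ 2 / 2 : ℝ))‖ ≤
      2 / 9 * U e ^ 2 := by
    intro e
    have hn : ‖(U e : ℂ) * Complex.I‖ = |U e| := by simp
    have := Complex.exp_bound (x := U e * Complex.I) (by rw [hn]; exact h1 e) (n := 3) (by norm_num)
    rw [hn] at this
    simp only [Finset.sum_range_succ, Finset.sum_range_zero, Nat.factorial] at this
    have e1 : ((U e : ℂ) * Complex.I) ^ 2 = -(U e : ℂ) ^ 2 := by
      rw [mul_pow, Complex.I_sq]; ring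
    rw [e1] at this
    norm_num at this
    have h3 : |U e| ^ 3 ≤ U e ^ 2 := by
      rw [pow_succ, sq_abs]
      exact mul_le_of_le_one_right (sq_nonneg _) (h1 e)
    refine le_trans (le_of_eq ?_) (this.trans (by linarith))
    congr 1
    push_cast
    ring
  have hint : charAt ν U - ((1 - W / 2 : ℝ) : ℂ) =
      ∫ e, (Complex.exp (U e * Complex.I) - ((1 : ℂ) + U e * Complex.I - (U e ^ 2 / 2 : ℝ))) ∂ν := by
    have i1 : Integrable (fun e => (U e : ℂ) * Complex.I) ν := hi1.ofReal.mul_const _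
    have i2 : Integrable (fun e => ((U e ^ 2 / 2 : ℝ) : ℂ)) ν := (hi2.div_const 2).ofReal
    have i3 : Integrable (fun e => (1 : ℂ) + U e * Complex.I) ν := (integrable_const _).fun_add i1
    have i4 : Integrable (fun e => (1 : ℂ) + U e * Complex.I - ((U e ^ 2 / 2 : ℝ) : ℂ)) ν := i3.sub i2
    rw [integral_sub (integrable_complex_of_dependsOn
      (dependsOn_comp hU fun x : ℝ => Complex.exp (x * Complex.I))) i4,
      integral_sub i3 i2, integral_add (integrable_const _) i1, integral_mul_const,
      integral_complex_ofReal, integral_complex_ofReal, h0, integral_div, ← hW, charAt]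
    simp
  have hb : ‖charAt ν U - ((1 - W / 2 : ℝ) : ℂ)‖ ≤ 2 / 9 * W := by
    rw [hint]
    refine (norm_integral_le_of_norm_le (hi2.const_mul (2 / 9)) (Eventually.of_forall hpt)).trans ?_
    rw [integral_const_mul]
  have h2 : ‖((1 - W / 2 : ℝ) : ℂ)‖ = 1 - W / 2 := by
    rw [Complex.norm_real, Real.norm_of_nonneg (by linarith)]
  have h3 := norm_sub_norm_le (charAt ν U) ((1 - W / 2 : ℝ) : ℂ)
  have h4 := Real.add_one_le_exp (-W / 4)
  rw [h2] at h3
  linarith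

/-- Each block sum is centred and bounded by 1, and its variance is at least its diagonal part since
covariances are nonnegative. The Gaussian bounds of the blocks multiply to one for the whole sum. -/
theorem norm_charAt_linSum_le (hν : PositivelyCorrelated ν)
    (hmean : ∀ y, ∫ e : ℤ → ℤˣ, ((e y : ℤ) : ℝ) ∂ν = 0) (s : Finset ℤ) {a : ℤ → ℝ}
    (ha : ∀ y, 0 ≤ a y) (blk : ℤ → ℤ) (hblk : ∀ b, ∑ y ∈ s with blk y = b, a y ≤ 1) :
    ‖charAt ν (linSum s a)‖ ≤
      Real.exp (-(∑ y ∈ s, a y ^ 2) / 4) + 4 * crossCov ν s a blk := by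
  have habs : ∀ (e : ℤ → ℤˣ) y, |((e y : ℤ) : ℝ)| = 1 := fun e y => by
    rcases Int.units_eq_one_or (e y) with h | h <;> simp [h]
  have hvar : ∀ y, pairCov ν y y = 1 := by
    intro y
    have hm : MemLp (fun e : ℤ → ℤˣ => ((e y : ℤ) : ℝ)) 2 ν :=
      memLp_of_dependsOn (dependsOn_coord y (Finset.mem_singleton_self y))
    rw [pairCov, covariance_eq_sub hm hm, hmean]
    have : ∀ e : ℤ → ℤˣ, ((e y : ℤ) : ℝ) * ((e y : ℤ) : ℝ) = 1 := by
      intro e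
      rw [← abs_mul_abs_self, habs]; norm_num
    simp [this]
  have hblock : ∀ b, ‖charAt ν (linSum (s.filter fun y => blk y = b) a)‖ ≤
      Real.exp (-(∑ y ∈ s with blk y = b, a y ^ 2) / 4) := by
    intro b
    set t := s.filter fun y => blk y = b
    have hd := dependsOn_linSum (Finset.Subset.refl t) a
    have h0 : ∫ e, linSum t a e ∂ν = 0 := by
      unfold linSum
      rw [integral_finsetSum]
      · simp [integral_const_mul, hmean]
      · intro y hy
        exact (integrable_of_dependsOn (dependsOn_coord y hy)).const_mul _
    have h1 : ∀ e, |linSum t a e| ≤ 1 := by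
      intro e
      refine (Finset.abs_sum_le_sum_abs _ _).trans (le_trans (le_of_eq ?_) (hblk b))
      refine Finset.sum_congr rfl fun y _ => ?_
      rw [abs_mul, habs, mul_one, abs_of_nonneg (ha y)]
    refine (norm_charAt_le_exp hd h0 h1).trans (Real.exp_le_exp.2 ?_)
    have hsq : ∫ e, linSum t a e ^ 2 ∂ν = cov[linSum t a, linSum t a; ν] := by
      rw [covariance_eq_sub (memLp_of_dependsOn hd) (memLp_of_dependsOn hd), h0]
      simp [pow_two]
    rw [hsq, cov_linSum]
    have : ∑ y ∈ t, a y ^ 2 ≤ ∑ y ∈ t, ∑ z ∈ t, a y * a z * pairCov ν y z := by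
      refine Finset.sum_le_sum fun y hy => ?_
      have := Finset.single_le_sum (f := fun z => a y * a z * pairCov ν y z)
        (fun z _ => mul_nonneg (mul_nonneg (ha y) (ha z)) (pairCov_nonneg hν y z)) hy
      rw [hvar, mul_one, ← pow_two] at this
      exact this
    linarith
  have hN := norm_charAt_sub_prod_le hν s ha blk (s.image blk)
  have hs : (s.filter fun y => blk y ∈ s.image blk) = s :=
    Finset.filter_true_of_mem fun y hy => Finset.mem_image_of_mem blk hy
  rw [hs] at hN
  have hprod : ‖∏ b ∈ s.image blk, charAt ν (linSum (s.filter fun y => blk y = b) a)‖ ≤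
      Real.exp (-(∑ y ∈ s, a y ^ 2) / 4) := by
    rw [norm_prod]
    refine (Finset.prod_le_prod (fun _ _ => norm_nonneg _) fun b _ => hblock b).trans (le_of_eq ?_)
    rw [← Real.exp_sum, ← Finset.sum_div, Finset.sum_neg_distrib,
      Finset.sum_fiberwise_of_maps_to fun y hy => Finset.mem_image_of_mem blk hy]
  have := norm_le_norm_add_norm_sub' (charAt ν (linSum s a))
    (∏ b ∈ s.image blk, charAt ν (linSum (s.filter fun y => blk y = b) a))
  linarith

end

/-! ### Anticoncentration for associated fields with summable correlations -/

/-- Raising y by one telescopes the sum of the quotients up by exactly 1 (a form of Hermite's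
identity). -/
theorem sum_ediv_sub_ediv {L : ℕ} (hL : 0 < L) (y z : ℤ) :
    ∑ h ∈ Finset.range L, ((z + h) / (L : ℤ) - (y + h) / (L : ℤ)) = z - y := by
  have hL0 : (L : ℤ) ≠ 0 := by exact_mod_cast hL.ne'
  have hstep : ∀ y : ℤ, ∑ h ∈ Finset.range L, (y + 1 + h) / (L : ℤ) =
      ∑ h ∈ Finset.range L, (y + h) / (L : ℤ) + 1 := by
    intro y
    have h1 := Finset.sum_range_sub (fun h : ℕ => (y + h) / (L : ℤ)) L
    simp only [Nat.cast_zero, add_zero] at h1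
    rw [Finset.sum_sub_distrib, Int.add_ediv_of_dvd_right dvd_rfl, Int.ediv_self hL0] at h1
    have h2 : ∀ h : ℕ, (y + ((h + 1 : ℕ) : ℤ)) / (L : ℤ) = (y + 1 + h) / (L : ℤ) := fun h => by
      push_cast; congr 1; ring
    simp only [h2] at h1
    linarith
  have hg : ∀ y : ℤ, ∑ h ∈ Finset.range L, (y + h) / (L : ℤ) =
      y + ∑ h ∈ Finset.range L, (0 + h : ℤ) / (L : ℤ) := by
    intro y
    induction y using Int.induction_on with
    | zero => simp
    | succ i ih => rw [hstep, ih]; ring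
    | pred i ih =>
      have := hstep (-i - 1)
      rw [sub_add_cancel, ih] at this
      linarith
  rw [Finset.sum_sub_distrib, hg z, hg y]
  ring

theorem sum_ite_ediv_ne_le {L : ℕ} (hL : 0 < L) (y z : ℤ) :
    ∑ h ∈ Finset.range L, (if (y + h) / (L : ℤ) ≠ (z + h) / (L : ℤ) then (1 : ℝ) else 0) ≤
      |((y - z : ℤ) : ℝ)| := by
  wlog hyz : y ≤ z generalizing y z
  · have := this z y (le_of_not_ge hyz)
    rw [← abs_neg, ← Int.cast_neg, neg_sub]
    simpa only [ne_comm] using this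
  have h1 : ((∑ h ∈ Finset.range L, ((z + h) / (L : ℤ) - (y + h) / (L : ℤ)) : ℤ) : ℝ) =
      |((y - z : ℤ) : ℝ)| := by
    rw [sum_ediv_sub_ediv hL, abs_of_nonpos (by exact_mod_cast sub_nonpos.2 hyz)]
    push_cast; ring
  rw [← h1, Int.cast_sum]
  refine Finset.sum_le_sum fun h _ => ?_
  have h2 : (y + h) / (L : ℤ) ≤ (z + h) / (L : ℤ) :=
    Int.ediv_le_ediv (by exact_mod_cast hL) (by linarith)
  split_ifs with h3
  · have : (1 : ℤ) ≤ (z + h) / (L : ℤ) - (y + h) / (L : ℤ) := by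
      have := lt_of_le_of_ne h2 h3; omega
    exact_mod_cast this
  · exact_mod_cast sub_nonneg.2 h2

/-- The number of grid shifts separating y from z is at most both L and |y - z|; interpolate between
the two with weights 1 - β and β. -/
theorem sum_ite_ediv_ne_le_rpow {L : ℕ} (hL : 0 < L) {β : ℝ} (hβ0 : 0 < β) (hβ1 : β ≤ 1)
    (y z : ℤ) :
    ∑ h ∈ Finset.range L, (if (y + h) / (L : ℤ) ≠ (z + h) / (L : ℤ) then (1 : ℝ) else 0) ≤
      (L : ℝ) * (L : ℝ) ^ (-β) * |((y - z : ℤ) : ℝ)| ^ β := by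
  have hLr : (0 : ℝ) < L := by exact_mod_cast hL
  set N := ∑ h ∈ Finset.range L, (if (y + h) / (L : ℤ) ≠ (z + h) / (L : ℤ) then (1 : ℝ) else 0)
  have h1 : N ≤ |((y - z : ℤ) : ℝ)| := sum_ite_ediv_ne_le hL y z
  have h2 : N ≤ L := by
    refine (Finset.sum_le_card_nsmul _ _ 1 fun h _ => by split_ifs <;> norm_num).trans ?_
    simp
  have h0 : 0 ≤ N := Finset.sum_nonneg fun h _ => by split_ifs <;> norm_num
  calc N = N ^ (1 - β) * N ^ β := by
        rw [← Real.rpow_add' h0 (by simp)]; simp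
    _ ≤ (L : ℝ) ^ (1 - β) * |((y - z : ℤ) : ℝ)| ^ β := by gcongr
    _ = _ := by rw [sub_eq_add_neg, Real.rpow_add hLr, Real.rpow_one]

theorem card_filter_ediv_le {L : ℕ} (hL : 0 < L) (h : ℕ) (b : ℤ) (s : Finset ℤ) :
    (s.filter fun y : ℤ => (y + h) / (L : ℤ) = b).card ≤ L := by
  have hL' : (0 : ℤ) < L := by exact_mod_cast hL
  have : (s.filter fun y : ℤ => (y + h) / (L : ℤ) = b) ⊆ Finset.Ico (b * L - h) (b * L - h + L) := by
    intro y hy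
    obtain ⟨_, hy⟩ := Finset.mem_filter.1 hy
    rw [Finset.mem_Ico, ← hy]
    have h1 := Int.ediv_mul_le (y + h) hL'.ne'
    have h2 := Int.lt_ediv_add_one_mul_self (y + h) hL'
    constructor <;> linarith
  simpa using Finset.card_le_card this

section

variable {ν : Measure (ℤ → ℤˣ)}

theorem pairCov_comm (y z : ℤ) : pairCov ν y z = pairCov ν z y := covariance_comm _ _

/-- Average over the L shifts of the grid: a pair is separated for a proportion at most (|y -
z|/L)^β of them. Then 2 a_y a_z ≤ a_y² + a_z² and the row-sum bound C give the estimate for the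
mean, so some shift attains it. -/
theorem exists_shift_crossCov_le (hν : PositivelyCorrelated ν) {β C : ℝ} (hβ0 : 0 < β)
    (hβ1 : β ≤ 1) (hC : ∀ (s : Finset ℤ) y, ∑ z ∈ s, pairCov ν y z * |((y - z : ℤ) : ℝ)| ^ β ≤ C)
    (s : Finset ℤ) {a : ℤ → ℝ} (ha : ∀ y, 0 ≤ a y) {L : ℕ} (hL : 0 < L) :
    ∃ h : ℕ, crossCov ν s a (fun y => (y + h) / (L : ℤ)) ≤ (L : ℝ) ^ (-β) * C * ∑ y ∈ s, a y ^ 2 := by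
  have hLr : (0 : ℝ) < L := by exact_mod_cast hL
  set w : ℤ → ℤ → ℝ := fun y z => pairCov ν y z * |((y - z : ℤ) : ℝ)| ^ β with hw
  have hw0 : ∀ y z, 0 ≤ w y z := fun y z =>
    mul_nonneg (pairCov_nonneg hν y z) (Real.rpow_nonneg (abs_nonneg _) _)
  have hwc : ∀ y z, w y z = w z y := fun y z => by
    simp only [hw, pairCov_comm y z]
    rw [← abs_neg, ← Int.cast_neg, neg_sub]
  have hquad : ∑ y ∈ s, ∑ z ∈ s, a y * a z * w y z ≤ C * ∑ y ∈ s, a y ^ 2 := by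
    have e1 : ∑ y ∈ s, ∑ z ∈ s, a y ^ 2 * w y z ≤ C * ∑ y ∈ s, a y ^ 2 := by
      rw [Finset.mul_sum]
      refine Finset.sum_le_sum fun y _ => ?_
      rw [← Finset.mul_sum, mul_comm C]
      exact mul_le_mul_of_nonneg_left (hC s y) (sq_nonneg _)
    have e2 : ∑ y ∈ s, ∑ z ∈ s, a z ^ 2 * w y z = ∑ y ∈ s, ∑ z ∈ s, a y ^ 2 * w y z := by
      rw [Finset.sum_comm]
      exact Finset.sum_congr rfl fun y _ => Finset.sum_congr rfl fun z _ => by rw [hwc]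
    have e3 : ∑ y ∈ s, ∑ z ∈ s, a y * a z * w y z ≤
        ∑ y ∈ s, ∑ z ∈ s, (a y ^ 2 * w y z + a z ^ 2 * w y z) / 2 := by
      refine Finset.sum_le_sum fun y _ => Finset.sum_le_sum fun z _ => ?_
      nlinarith [mul_nonneg (sq_nonneg (a y - a z)) (hw0 y z)]
    refine e3.trans ?_
    simp only [← Finset.sum_div, Finset.sum_add_distrib]
    rw [e2]
    linarith
  have hsum : ∑ h ∈ Finset.range L, crossCov ν s a (fun y => (y + h) / (L : ℤ)) ≤
      ∑ _h ∈ Finset.range L, (L : ℝ) ^ (-β) * C * ∑ y ∈ s, a y ^ 2 := by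
    unfold crossCov
    rw [Finset.sum_comm]
    calc _ = ∑ y ∈ s, ∑ z ∈ s, a y * a z * pairCov ν y z * ∑ h ∈ Finset.range L,
          (if (y + h) / (L : ℤ) ≠ (z + h) / (L : ℤ) then (1 : ℝ) else 0) := by
          refine Finset.sum_congr rfl fun y _ => ?_
          rw [Finset.sum_comm]
          refine Finset.sum_congr rfl fun z _ => ?_
          rw [Finset.mul_sum]
          exact Finset.sum_congr rfl fun h _ => by split_ifs <;> simp
      _ ≤ ∑ y ∈ s, ∑ z ∈ s, a y * a z * pairCov ν y z *
          ((L : ℝ) * (L : ℝ) ^ (-β) * |((y - z : ℤ) : ℝ)| ^ β) := by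
          refine Finset.sum_le_sum fun y _ => Finset.sum_le_sum fun z _ => ?_
          exact mul_le_mul_of_nonneg_left (sum_ite_ediv_ne_le_rpow hL hβ0 hβ1 y z)
            (mul_nonneg (mul_nonneg (ha y) (ha z)) (pairCov_nonneg hν y z))
      _ = (L : ℝ) * (L : ℝ) ^ (-β) * ∑ y ∈ s, ∑ z ∈ s, a y * a z * w y z := by
          simp only [Finset.mul_sum, hw]
          exact Finset.sum_congr rfl fun y _ => Finset.sum_congr rfl fun z _ => by ring
      _ ≤ (L : ℝ) * (L : ℝ) ^ (-β) * (C * ∑ y ∈ s, a y ^ 2) := by gcongr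
      _ = _ := by rw [Finset.sum_const, Finset.card_range, nsmul_eq_mul]; ring
  obtain ⟨h, -, hh⟩ := Finset.exists_le_of_sum_le (Finset.nonempty_range_iff.2 hL.ne') hsum
  exact ⟨h, hh⟩

variable [IsProbabilityMeasure ν]

theorem norm_charAt_smul_linSum_le (hν : PositivelyCorrelated ν)
    (hmean : ∀ y, ∫ e : ℤ → ℤˣ, ((e y : ℤ) : ℝ) ∂ν = 0) {β C : ℝ} (hβ0 : 0 < β)
    (hβ1 : β ≤ 1) (hC : ∀ (s : Finset ℤ) y, ∑ z ∈ s, pairCov ν y z * |((y - z : ℤ) : ℝ)| ^ β ≤ C)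
    (s : Finset ℤ) {a : ℤ → ℝ} (ha : ∀ y, 0 ≤ a y) {B : ℝ} (haB : ∀ y, a y ≤ B) {L : ℕ}
    (hL : 0 < L) {t : ℝ} (ht : 0 ≤ t) (htB : t * L * B ≤ 1) :
    ‖charAt ν fun e => t * linSum s a e‖ ≤
      Real.exp (-(t ^ 2 * ∑ y ∈ s, a y ^ 2) / 4) +
        4 * ((L : ℝ) ^ (-β) * C * (t ^ 2 * ∑ y ∈ s, a y ^ 2)) := by
  have hta : ∀ y, 0 ≤ t * a y := fun y => mul_nonneg ht (ha y)
  have hB : 0 ≤ B := (ha 0).trans (haB 0)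
  obtain ⟨h, hh⟩ := exists_shift_crossCov_le hν hβ0 hβ1 hC s hta hL
  have hfun : (fun e => t * linSum s a e) = linSum s fun y => t * a y := by
    ext e; simp [linSum, Finset.mul_sum, mul_assoc]
  have hsq : ∑ y ∈ s, (t * a y) ^ 2 = t ^ 2 * ∑ y ∈ s, a y ^ 2 := by
    simp [Finset.mul_sum, mul_pow]
  rw [hfun, ← hsq]
  refine (norm_charAt_linSum_le hν hmean s hta (fun y => (y + h) / (L : ℤ)) fun b => ?_).trans ?_
  · refine (Finset.sum_le_card_nsmul _ _ (t * B) fun y _ =>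
      mul_le_mul_of_nonneg_left (haB y) ht).trans ?_
    rw [nsmul_eq_mul]
    have : (((s.filter fun y : ℤ => (y + h) / (L : ℤ) = b).card : ℕ) : ℝ) ≤ L := by
      exact_mod_cast card_filter_ediv_le hL h b s
    calc _ ≤ (L : ℝ) * (t * B) := by gcongr
      _ ≤ 1 := by linarith
  · gcongr

theorem sum_cos_sub_eq (K : ℕ) (x : ℝ) :
    ∑ k ∈ Finset.range K, ∑ l ∈ Finset.range K, Real.cos (((k : ℝ) - l) * x) =
      (∑ k ∈ Finset.range K, Real.cos (k * x)) ^ 2 +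
        (∑ k ∈ Finset.range K, Real.sin (k * x)) ^ 2 := by
  simp only [sub_mul, Real.cos_sub, Finset.sum_add_distrib, pow_two, Finset.sum_mul_sum]

theorem sq_div_four_le_sum_cos {K : ℕ} {x : ℝ} (hx : K * |x| ≤ 1) :
    (K : ℝ) ^ 2 / 4 ≤ ∑ k ∈ Finset.range K, ∑ l ∈ Finset.range K, Real.cos (((k : ℝ) - l) * x) := by
  have h2 : (K : ℝ) / 2 ≤ ∑ k ∈ Finset.range K, Real.cos (k * x) := by
    have : ∀ k ∈ Finset.range K, (1 / 2 : ℝ) ≤ Real.cos (k * x) := by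
      intro k hk
      have hk' : (k : ℝ) ≤ K := by exact_mod_cast (Finset.mem_range.1 hk).le
      have h3 : |(k : ℝ) * x| ≤ 1 := by
        rw [abs_mul, Nat.abs_cast]
        exact (mul_le_mul_of_nonneg_right hk' (abs_nonneg x)).trans hx
      have h4 := Real.one_sub_sq_div_two_le_cos (x := k * x)
      have h5 := (sq_le_one_iff_abs_le_one _).2 h3
      linarith
    have := Finset.card_nsmul_le_sum _ _ _ this
    simp only [Finset.card_range, nsmul_eq_mul] at this
    linarith
  rw [sum_cos_sub_eq]
  nlinarith [sq_nonneg (∑ k ∈ Finset.range K, Real.sin (k * x)), (Nat.cast_nonneg K : (0 : ℝ) ≤ K)]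

/-- The kernel ∑ cos((k - l)x) over k, l < K is |∑ e^(ikx)|², so it is nonnegative, and it is at
least K²/4 when K|x| ≤ 1. Its mean at x = tU is at most K from the diagonal plus K²M, and only the
frequencies t, …, (K - 1)t enter. -/
theorem measureReal_abs_le_le {s : Finset ℤ} {U : (ℤ → ℤˣ) → ℝ} (hU : DependsOn U s) {K : ℕ}
    (hK : 0 < K) {t M : ℝ} (ht : 0 < t)
    (hM : ∀ j : ℕ, 0 < j → j < K → ‖charAt ν fun e => (j * t) * U e‖ ≤ M) (hM0 : 0 ≤ M) :
    ν.real {e | |U e| ≤ 1 / (K * t)} ≤ 4 / K + 4 * M := by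
  have hKr : (0 : ℝ) < K := by exact_mod_cast hK
  have hmeas : MeasurableSet {e | |U e| ≤ 1 / (K * t)} :=
    measurableSet_le (measurable_of_dependsOn hU).abs measurable_const
  have hcos : ∀ x : ℝ, Integrable (fun e => Real.cos (x * (t * U e))) ν := fun x =>
    integrable_of_dependsOn (dependsOn_comp hU fun u => Real.cos (x * (t * u)))
  have hint : ∀ k ∈ Finset.range K, ∀ l ∈ Finset.range K,
      ∫ e, Real.cos (((k : ℝ) - l) * (t * U e)) ∂ν ≤ (if k = l then 1 else 0) + M := by
    have key : ∀ j : ℕ, 0 < j → j < K → ∫ e, Real.cos ((j : ℝ) * (t * U e)) ∂ν ≤ M := by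
      intro j h0 h1
      refine le_trans ?_ (hM j h0 h1)
      rw [charAt_eq (dependsOn_comp hU fun u => (j * t) * u)]
      refine le_trans (le_of_eq ?_) (Complex.re_le_norm _)
      simp [mul_assoc]
    intro k hk l hl
    rw [Finset.mem_range] at hk hl
    split_ifs with h
    · simp [h, hM0]
    · rw [zero_add]
      rcases lt_or_gt_of_ne h with h | h
      · have := key (l - k) (by omega) (by omega)
        rw [Nat.cast_sub h.le] at this
        refine le_trans (le_of_eq (integral_congr_ae (Eventually.of_forall fun e => ?_))) this
        beta_reduce
        rw [← Real.cos_neg]; congr 1; ring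
      · have := key (k - l) (by omega) (by omega)
        rwa [Nat.cast_sub h.le] at this
  have hsum : Integrable (fun e => ∑ k ∈ Finset.range K, ∑ l ∈ Finset.range K,
      Real.cos (((k : ℝ) - l) * (t * U e))) ν :=
    integrable_finsetSum _ fun k _ => integrable_finsetSum _ fun l _ => hcos _
  have hnn : ∀ x : ℝ, 0 ≤ ∑ k ∈ Finset.range K, ∑ l ∈ Finset.range K,
      Real.cos (((k : ℝ) - l) * x) := by
    intro x
    rw [sum_cos_sub_eq]; positivity
  have h1 : (K : ℝ) ^ 2 / 4 * ν.real {e | |U e| ≤ 1 / (K * t)} ≤ K + K ^ 2 * M := by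
    calc (K : ℝ) ^ 2 / 4 * ν.real {e | |U e| ≤ 1 / (K * t)}
        = ∫ e, Set.indicator {e | |U e| ≤ 1 / (K * t)} (fun _ => (K : ℝ) ^ 2 / 4) e ∂ν := by
          rw [integral_indicator_const _ hmeas, smul_eq_mul, mul_comm]
      _ ≤ ∫ e, ∑ k ∈ Finset.range K, ∑ l ∈ Finset.range K,
          Real.cos (((k : ℝ) - l) * (t * U e)) ∂ν := by
          refine integral_mono ((integrable_const _).indicator hmeas) hsum fun e => ?_
          by_cases he : e ∈ {e | |U e| ≤ 1 / (K * t)}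
          · rw [Set.indicator_of_mem he]
            refine sq_div_four_le_sum_cos ?_
            rw [abs_mul, abs_of_pos ht]
            have he' : |U e| ≤ 1 / (K * t) := he
            rw [le_div_iff₀ (by positivity)] at he'
            linarith
          · rw [Set.indicator_of_notMem he]
            exact hnn _
      _ = ∑ k ∈ Finset.range K, ∑ l ∈ Finset.range K,
          ∫ e, Real.cos (((k : ℝ) - l) * (t * U e)) ∂ν := by
          rw [integral_finsetSum _ fun k _ => integrable_finsetSum _ fun l _ => hcos _]
          exact Finset.sum_congr rfl fun k _ => integral_finsetSum _ fun l _ => hcos _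
      _ ≤ ∑ k ∈ Finset.range K, ∑ l ∈ Finset.range K, ((if k = l then 1 else 0) + M) :=
          Finset.sum_le_sum fun k hk => Finset.sum_le_sum fun l hl => hint k hk l hl
      _ = K + K ^ 2 * M := by
          have h : (Finset.range K).filter (· < K) = Finset.range K :=
            Finset.filter_true_of_mem fun k hk => Finset.mem_range.1 hk
          simp [Finset.sum_add_distrib, pow_two, mul_assoc, h]
  have h2 : ν.real {e | |U e| ≤ 1 / (K * t)} ≤ (K + K ^ 2 * M) / (K ^ 2 / 4) := by
    rw [le_div_iff₀ (by positivity)]; linarith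
  refine h2.trans (le_of_eq ?_)
  field_simp

/-- Over the frequencies jt with 1 ≤ j < K, the Gaussian term is bounded by its value at j = 1,
while the cross term and the constraint on block sums are bounded by their values at j = K. -/
theorem measureReal_abs_linSum_le (hν : PositivelyCorrelated ν)
    (hmean : ∀ y, ∫ e : ℤ → ℤˣ, ((e y : ℤ) : ℝ) ∂ν = 0) {β C : ℝ} (hβ0 : 0 < β)
    (hβ1 : β ≤ 1) (hC : ∀ (s : Finset ℤ) y, ∑ z ∈ s, pairCov ν y z * |((y - z : ℤ) : ℝ)| ^ β ≤ C)
    (s : Finset ℤ) {a : ℤ → ℝ} (ha : ∀ y, 0 ≤ a y) {B : ℝ} (haB : ∀ y, a y ≤ B) {L K : ℕ}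
    (hL : 0 < L) (hK : 0 < K) {t : ℝ} (ht : 0 < t) (htB : K * t * L * B ≤ 1) :
    ν.real {e | |linSum s a e| ≤ 1 / (K * t)} ≤
      4 / K + 4 * (Real.exp (-(t ^ 2 * ∑ y ∈ s, a y ^ 2) / 4) +
        4 * ((L : ℝ) ^ (-β) * C * (K ^ 2 * (t ^ 2 * ∑ y ∈ s, a y ^ 2)))) := by
  have hB : 0 ≤ B := (ha 0).trans (haB 0)
  have hC0 : 0 ≤ C := by simpa using hC ∅ 0
  have hQ : 0 ≤ ∑ y ∈ s, a y ^ 2 := Finset.sum_nonneg fun y _ => sq_nonneg _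
  refine measureReal_abs_le_le (dependsOn_linSum (Finset.Subset.refl s) a) hK ht
    (fun j h0 h1 => ?_) (by positivity)
  have hj1 : (1 : ℝ) ≤ j := by exact_mod_cast h0
  have hjK : (j : ℝ) ≤ K := by exact_mod_cast h1.le
  refine (norm_charAt_smul_linSum_le hν hmean hβ0 hβ1 hC s ha haB hL (t := j * t) (by positivity)
    (le_trans (by gcongr) htB)).trans ?_
  have e1 : t ^ 2 * ∑ y ∈ s, a y ^ 2 ≤ (j * t) ^ 2 * ∑ y ∈ s, a y ^ 2 := by
    gcongr; exact le_mul_of_one_le_left ht.le hj1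
  have e2 : (j * t) ^ 2 * ∑ y ∈ s, a y ^ 2 ≤ K ^ 2 * (t ^ 2 * ∑ y ∈ s, a y ^ 2) := by
    rw [← mul_assoc, ← mul_pow]; gcongr
  gcongr

end

/-! ### The law of the field -/

section

variable {Ω : Type*} [MeasurableSpace Ω] {P : Measure Ω} {ε : ℤ → Ω → ℤˣ}

theorem measurable_field (hmeas : ∀ y, Measurable (ε y)) : Measurable fun ω y => ε y ω :=
  measurable_pi_lambda _ hmeas

theorem positivelyCorrelated_fieldLaw [IsProbabilityMeasure P] (hmeas : ∀ y, Measurable (ε y))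
    (hstat : IsStationary P ε) (hassoc : IsAssociated P ε) :
    PositivelyCorrelated (fieldLaw P ε) := by
  intro s F G hF hG hFm hGm
  obtain ⟨N, hN⟩ : ∃ N : ℕ, ∀ y ∈ s, y.natAbs ≤ N :=
    ⟨s.sup Int.natAbs, fun y hy => Finset.le_sup (f := Int.natAbs) hy⟩
  set ext : (Fin (2 * N + 1) → ℤˣ) → ℤ → ℤˣ := fun x y =>
    -- Stationarity moves the coordinates into 0, …, 2N. The value 1 outside the window is
    -- immaterial, but being constant it keeps the extension monotone.
    if h : (y + N).toNat < 2 * N + 1 then x ⟨(y + N).toNat, h⟩ else 1 with hext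
  have hmono : Monotone ext := by
    intro x x' h y
    simp only [hext]
    split_ifs
    · exact h _
    · exact le_rfl
  have hcomp : ∀ {F : (ℤ → ℤˣ) → ℝ}, DependsOn F s → ∀ ω,
      F (fun y => ε (y + N) ω) = F (ext fun i : Fin (2 * N + 1) => ε (i : ℕ) ω) := by
    intro F hF ω
    refine hF fun y hy => ?_
    have hy' := hN y hy
    have h1 : (y + N).toNat < 2 * N + 1 := by omega
    have h2 : (((y + N).toNat : ℕ) : ℤ) = y + N := by omega
    simp only [hext, h1, dif_pos, h2]
  rw [← hstat N, fieldLaw, covariance_map_fun (measurable_of_dependsOn hF).aestronglyMeasurable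
    (measurable_of_dependsOn hG).aestronglyMeasurable
    (measurable_field fun y => hmeas (y + N)).aemeasurable]
  simp only [hcomp hF, hcomp hG]
  exact hassoc (2 * N) _ _ (hFm.comp hmono) (hGm.comp hmono)

theorem integral_coord_fieldLaw (hmeas : ∀ y, Measurable (ε y)) (hsymm : IsSymmetric P ε) (y : ℤ) :
    ∫ e : ℤ → ℤˣ, ((e y : ℤ) : ℝ) ∂(fieldLaw P ε) = 0 := by
  have hm : ∀ μ : Measure ℤˣ, AEStronglyMeasurable (fun σ : ℤˣ => ((σ : ℤ) : ℝ)) μ := fun μ =>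
    (Measurable.of_discrete).aestronglyMeasurable
  have h1 : ∫ e : ℤ → ℤˣ, ((e y : ℤ) : ℝ) ∂(fieldLaw P ε) = ∫ ω, ((ε y ω : ℤ) : ℝ) ∂P :=
    integral_map (measurable_field hmeas).aemeasurable
      (measurable_of_dependsOn (dependsOn_coord y (Finset.mem_singleton_self y))).aestronglyMeasurable
  have h2 := congrArg (fun μ => ∫ σ : ℤˣ, ((σ : ℤ) : ℝ) ∂μ) (hsymm y)
  have hneg : Measurable fun ω => -ε y ω :=
    (Measurable.of_discrete (f := fun σ : ℤˣ => -σ)).comp (hmeas y)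
  beta_reduce at h2
  rw [integral_map hneg.aemeasurable (hm _), integral_map (hmeas y).aemeasurable (hm _)] at h2
  simp only [Units.val_neg, Int.cast_neg, integral_neg] at h2
  rw [h1]
  linarith

theorem pairCov_fieldLaw [IsProbabilityMeasure P] (hmeas : ∀ y, Measurable (ε y))
    (hstat : IsStationary P ε) (hsymm : IsSymmetric P ε) (y z : ℤ) :
    pairCov (fieldLaw P ε) y z = correlation P ε (z - y) := by
  have hprob : ∀ ε : ℤ → Ω → ℤˣ, (∀ y, Measurable (ε y)) → IsProbabilityMeasure (fieldLaw P ε) :=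
    fun ε hmeas => Measure.isProbabilityMeasure_map (measurable_field hmeas).aemeasurable
  have hL : ∀ y : ℤ, MemLp (fun e : ℤ → ℤˣ => ((e y : ℤ) : ℝ)) 2 (fieldLaw P ε) := fun y =>
    have := hprob ε hmeas
    memLp_of_dependsOn (dependsOn_coord y (Finset.mem_singleton_self y))
  have hd : ∀ y z : ℤ, Measurable fun e : ℤ → ℤˣ => ((e y : ℤ) : ℝ) * ((e z : ℤ) : ℝ) := fun y z =>
    measurable_of_dependsOn (s := {y, z}) (dependsOn_comp₂ (dependsOn_coord y (by simp))
      (dependsOn_coord z (by simp)) (· * ·))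
  have h1 : ∀ (ε : ℤ → Ω → ℤˣ), (∀ y, Measurable (ε y)) → ∀ y z : ℤ,
      ∫ e : ℤ → ℤˣ, ((e y : ℤ) : ℝ) * ((e z : ℤ) : ℝ) ∂(fieldLaw P ε) =
      ∫ ω, ((ε y ω : ℤ) : ℝ) * ((ε z ω : ℤ) : ℝ) ∂P := fun ε hmeas y z =>
    integral_map (measurable_field hmeas).aemeasurable (hd y z).aestronglyMeasurable
  have h2 := h1 (fun x => ε (x + y)) (fun x => hmeas _) 0 (z - y)
  have := hprob ε hmeas
  rw [hstat y, h1 ε hmeas] at h2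
  rw [pairCov, covariance_eq_sub (hL y) (hL z), integral_coord_fieldLaw hmeas hsymm, zero_mul,
    sub_zero]
  simp only [Pi.mul_apply]
  rw [h1 ε hmeas, correlation, h2]
  simp

theorem exists_sum_pairCov_le [IsProbabilityMeasure P] (hmeas : ∀ y, Measurable (ε y))
    (hstat : IsStationary P ε) (hsymm : IsSymmetric P ε) (hassoc : IsAssociated P ε)
    {α : ℝ} (hα : 1 < α)
    (hdecay : correlation P ε =O[comap (fun y : ℤ => |y|) atTop] fun y : ℤ => |(y : ℝ)| ^ (-α)) :
    ∃ β C : ℝ, 0 < β ∧ β ≤ 1 ∧ ∀ (s : Finset ℤ) (y : ℤ),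
      ∑ z ∈ s, pairCov (fieldLaw P ε) y z * |((y - z : ℤ) : ℝ)| ^ β ≤ C := by
  -- Half of the excess α - 1 is spent on the weight |k|^β, leaving a decay exponent α - β > 1.
  set β := min 1 ((α - 1) / 2) with hβ
  have hβ0 : 0 < β := lt_min one_pos (by linarith)
  have hβ2 : β ≤ (α - 1) / 2 := min_le_right _ _
  set f : ℤ → ℝ := fun k => correlation P ε k * |(k : ℝ)| ^ β with hf
  have hf0 : ∀ k, 0 ≤ f k := fun k => by
    have := pairCov_nonneg (positivelyCorrelated_fieldLaw hmeas hstat hassoc) 0 k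
    rw [pairCov_fieldLaw hmeas hstat hsymm, sub_zero] at this
    exact mul_nonneg this (Real.rpow_nonneg (abs_nonneg _) _)
  have hcof : comap (fun y : ℤ => |y|) atTop = cofinite := by
    rw [Int.cofinite_eq]; exact comap_abs_atTop
  have hsum : Summable f := by
    refine summable_of_isBigO (Real.summable_abs_int_rpow (b := α - β) (by linarith)) ?_
    rw [hcof] at hdecay
    have h1 := hdecay.mul (isBigO_refl (fun k : ℤ => |(k : ℝ)| ^ β) cofinite)
    refine h1.trans_eventuallyEq ?_
    have h0 : ∀ᶠ k : ℤ in cofinite, k ≠ 0 := by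
      simpa using (Set.finite_singleton (0 : ℤ)).compl_mem_cofinite
    filter_upwards [h0] with k hk
    have : 0 < |(k : ℝ)| := abs_pos.2 (by exact_mod_cast hk)
    rw [← Real.rpow_add this]
    congr 1; ring
  refine ⟨β, ∑' k, f k, hβ0, min_le_left _ _, fun s y => ?_⟩
  have h1 : ∑' z, f (z - y) = ∑' k, f k := (Equiv.subRight y).tsum_eq f
  rw [← h1]
  refine le_trans (le_of_eq ?_) (((Equiv.subRight y).summable_iff.2 hsum).sum_le_tsum s
    fun z _ => hf0 _)
  refine Finset.sum_congr rfl fun z _ => ?_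
  rw [pairCov_fieldLaw hmeas hstat hsymm]
  simp only [hf]
  rw [← abs_neg, ← Int.cast_neg, neg_sub]

end

/-! ### Integrating the Green function over the field -/

theorem ceil_le_two_mul {x : ℝ} (hx : 1 ≤ x) : (⌈x⌉₊ : ℝ) ≤ 2 * x := by
  linarith [Nat.ceil_lt_add_one (show 0 ≤ x by linarith)]

theorem signSum_map (l : List ℤ) (e : ℤ → ℤˣ) :
    signSum (l.map e) = linSum l.toFinset (fun z => (l.count z : ℝ)) e := by
  rw [signSum, List.map_map, Finset.sum_list_map_count]
  simp [linSum]

theorem sum_count_toFinset (l : List ℤ) : ∑ z ∈ l.toFinset, (l.count z : ℝ) = l.length := by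
  exact_mod_cast List.sum_toFinset_count_eq_length l

/-- The path `l` stays within distance `A` of `y` and visits no point more than `A` times. -/
def Spread (A : ℕ) (y : ℤ) (l : List ℤ) : Prop :=
  (∀ z ∈ l, |z - y| ≤ A) ∧ ∀ z, l.count z ≤ A

/-- Cauchy–Schwarz for the local times, which live on at most 2A + 1 sites. -/
theorem Spread.length_sq_le {A : ℕ} {y : ℤ} {l : List ℤ} (h : Spread A y l) :
    (l.length : ℝ) ^ 2 ≤ (2 * A + 1) * ∑ z ∈ l.toFinset, (l.count z : ℝ) ^ 2 := by
  have h1 := sq_sum_le_card_mul_sum_sq (s := l.toFinset) (f := fun z => (l.count z : ℝ))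
  rw [sum_count_toFinset] at h1
  refine h1.trans ?_
  have h2 : l.toFinset ⊆ Finset.Icc (y - A) (y + A) := by
    intro z hz
    have := abs_le.1 (h.1 z (List.mem_toFinset.1 hz))
    rw [Finset.mem_Icc]; omega
  have h3 : l.toFinset.card ≤ 2 * A + 1 := by
    refine (Finset.card_le_card h2).trans ?_
    rw [Int.card_Icc]; omega
  have h4 : (l.toFinset.card : ℝ) ≤ 2 * A + 1 := by exact_mod_cast h3
  gcongr

theorem Spread.sum_sq_le {A : ℕ} {y : ℤ} {l : List ℤ} (h : Spread A y l) :
    ∑ z ∈ l.toFinset, (l.count z : ℝ) ^ 2 ≤ l.length * A := by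
  rw [← sum_count_toFinset, Finset.sum_mul]
  refine Finset.sum_le_sum fun z _ => ?_
  rw [pow_two]
  gcongr
  exact h.2 z

-- Markov's inequality for three exponential functionals, detecting an exit above, an exit below, or
-- an over-visited site. The rate 1/√m keeps cosh^m bounded; the rate `lam`, also of order 1/√m, is
-- the largest allowed in `pathAvg_pow_count_le`.
open Classical in
theorem pathAvg_not_spread_le {m A : ℕ} (hm : 0 < m) (y : ℤ) :
    pathAvg m y (fun l => if Spread A y l then 0 else 1) ≤
      ENNReal.ofReal ((4 * (m + 1) + 2 * (2 * A + 1)) * Real.exp (1 - A / (12 * √m))) := by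
  have hs : 1 ≤ √(m : ℝ) := Real.one_le_sqrt.2 (by exact_mod_cast hm)
  have hs2 : √(m : ℝ) ^ 2 = m := Real.sq_sqrt (by positivity)
  set lam : ℝ := 1 / (2 * (1 + 2 * √m)) with hlam
  set c : ℝ := 1 / √m with hc
  have hlam0 : 0 < lam := by positivity
  have hlam1 : lam ≤ 1 := by
    rw [hlam, div_le_one (by positivity)]; linarith
  have hlam6 : 1 / (6 * √m) ≤ lam := by
    rw [hlam]; exact one_div_le_one_div_of_le (by positivity) (by linarith)
  set g : ℝ → List ℤ → ℝ≥0∞ := fun c l =>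
    (l.map fun z : ℤ => ENNReal.ofReal (Real.exp (c * z))).sum with hg
  have hgmem : ∀ (c : ℝ) (l : List ℤ) z, z ∈ l → ENNReal.ofReal (Real.exp (c * z)) ≤ g c l :=
    fun c l z hz => List.single_le_sum (by simp) _ (List.mem_map_of_mem hz)
  have hexp : ∀ r s : ℝ, ENNReal.ofReal (Real.exp r) * ENNReal.ofReal (Real.exp s) =
      ENNReal.ofReal (Real.exp (r + s)) := fun r s => by
    rw [← ENNReal.ofReal_mul (Real.exp_pos _).le, Real.exp_add]
  have hpt : ∀ l : List ℤ, (if Spread A y l then 0 else 1 : ℝ≥0∞) ≤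
      (ENNReal.ofReal (Real.exp (-(c * y) - c * A)) * g c l +
        ENNReal.ofReal (Real.exp (c * y - c * A)) * g (-c) l) +
      ∑ z ∈ Finset.Icc (y - A) (y + A),
        ENNReal.ofReal (Real.exp (-(lam / 2 * A))) * (1 + ENNReal.ofReal lam) ^ l.count z := by
    intro l
    split_ifs with h
    · exact zero_le
    · by_cases h1 : ∀ z ∈ l, |z - y| ≤ A
      · have h2 : ∃ z, A < l.count z := by
          by_contra! h2; exact h ⟨h1, h2⟩
        obtain ⟨z, hz⟩ := h2
        have hzl : z ∈ l := List.count_pos_iff.1 (by omega)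
        have hzI : z ∈ Finset.Icc (y - A) (y + A) := by
          have := abs_le.1 (h1 z hzl)
          rw [Finset.mem_Icc]; omega
        refine le_add_left (le_trans ?_ (Finset.single_le_sum
          (f := fun z => ENNReal.ofReal (Real.exp (-(lam / 2 * A))) *
            (1 + ENNReal.ofReal lam) ^ l.count z) (fun _ _ => zero_le) hzI))
        rw [← ENNReal.ofReal_one, ← ENNReal.ofReal_add (by norm_num) hlam0.le,
          ← ENNReal.ofReal_pow (by positivity), ← ENNReal.ofReal_mul (by positivity)]
        refine ENNReal.ofReal_le_ofReal ?_
        have h3 : Real.exp (lam / 2) ≤ 1 + lam := by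
          have := Real.abs_exp_sub_one_sub_id_le (x := lam / 2)
            (by rw [abs_of_pos (by positivity)]; linarith)
          rw [abs_le] at this
          nlinarith
        calc (1 : ℝ) = Real.exp (-(lam / 2 * A)) * Real.exp (lam / 2) ^ A := by
              rw [← Real.exp_nat_mul, ← Real.exp_add]; ring_nf; simp
          _ ≤ Real.exp (-(lam / 2 * A)) * (1 + lam) ^ A := by gcongr
          _ ≤ _ := by
              gcongr
              linarith
      · push Not at h1
        obtain ⟨z, hzl, hz⟩ := h1
        have hzr : (A : ℝ) < |(z : ℝ) - y| := by exact_mod_cast hz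
        have hc0 : 0 < c := by positivity
        refine le_add_right ?_
        rcases lt_abs.1 hzr with h2 | h2
        · refine le_add_right (le_trans ?_ (mul_le_mul_right (hgmem c l z hzl) _))
          rw [hexp, ENNReal.one_le_ofReal, Real.one_le_exp_iff]
          nlinarith
        · refine le_add_left (le_trans ?_ (mul_le_mul_right (hgmem (-c) l z hzl) _))
          rw [hexp, ENNReal.one_le_ofReal, Real.one_le_exp_iff]
          nlinarith
  have hlamM : ENNReal.ofReal lam * ENNReal.ofReal (1 + 2 * √m) ≤ 2⁻¹ := by
    rw [← ENNReal.ofReal_mul hlam0.le, ← ENNReal.ofReal_ofNat 2,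
      ← ENNReal.ofReal_inv_of_pos (by norm_num)]
    refine ENNReal.ofReal_le_ofReal (le_of_eq ?_)
    rw [hlam]
    have : 1 + 2 * √(m : ℝ) ≠ 0 := by positivity
    field_simp
  have hsumm : ∀ (t : Finset ℤ) (F : ℤ → List ℤ → ℝ≥0∞),
      pathAvg m y (fun l => ∑ z ∈ t, F z l) = ∑ z ∈ t, pathAvg m y (F z) := by
    intro t F
    induction t using Finset.induction_on with
    | empty => simpa using pathAvg_const m y 0
    | insert a t ha ih => simp only [Finset.sum_insert ha, pathAvg_add, ih]
  refine (pathAvg_mono' fun l _ => hpt l).trans ?_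
  rw [pathAvg_add, pathAvg_add, pathAvg_const_mul, pathAvg_const_mul, hsumm]
  simp only [pathAvg_const_mul]
  have hcosh : ∀ c' : ℝ, c' ^ 2 = 1 / m → ENNReal.ofReal (Real.cosh c') ^ m ≤
      ENNReal.ofReal (Real.exp (1 / 2)) := by
    intro c' hc'
    rw [← ENNReal.ofReal_pow (Real.cosh_pos _).le]
    refine ENNReal.ofReal_le_ofReal ?_
    refine (pow_le_pow_left₀ (Real.cosh_pos _).le (Real.cosh_le_exp_half_sq c') m).trans ?_
    rw [← Real.exp_nat_mul, hc']
    refine Real.exp_le_exp.2 (le_of_eq ?_)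
    field_simp
  have hc2 : c ^ 2 = 1 / m := by rw [hc, div_pow, hs2, one_pow]
  have hcA : 1 / 2 - c * A ≤ 1 - A / (12 * √m) := by
    have : (A : ℝ) / (12 * √m) = c * A / 12 := by rw [hc]; field_simp
    have h0 : 0 ≤ c * A := by positivity
    linarith
  have hterm : ∀ c' r : ℝ, c' ^ 2 = 1 / m → r = -(c' * y) - c * A →
      ENNReal.ofReal (Real.exp r) * pathAvg m y (g c') ≤
      (m + 1) * ENNReal.ofReal (Real.exp (1 - A / (12 * √m))) := by
    intro c' r h1 h2
    calc _ ≤ ENNReal.ofReal (Real.exp r) * ((m + 1) * ENNReal.ofReal (Real.exp (1 / 2)) *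
          ENNReal.ofReal (Real.exp (c' * y))) := by
          gcongr
          refine (pathAvg_sum_exp_le m y c').trans ?_
          gcongr
          exact hcosh c' h1
      _ = (m + 1) * (ENNReal.ofReal (Real.exp r) * ENNReal.ofReal (Real.exp (1 / 2)) *
          ENNReal.ofReal (Real.exp (c' * y))) := by ring
      _ ≤ _ := by
          rw [hexp, hexp]
          gcongr
          rw [h2]
          linarith
  have hA6 : -(lam / 2 * A) ≤ 1 - A / (12 * √m) := by
    have : (A : ℝ) / (12 * √m) = 1 / (6 * √m) / 2 * A := by field_simp; ring
    have h0 : 1 / (6 * √m) / 2 * A ≤ lam / 2 * A := by gcongr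
    linarith
  have hcount : ∑ z ∈ Finset.Icc (y - A) (y + A), ENNReal.ofReal (Real.exp (-(lam / 2 * A))) *
      pathAvg m y (fun l => (1 + ENNReal.ofReal lam) ^ l.count z) ≤
      (2 * A + 1) * (2 * ENNReal.ofReal (Real.exp (1 - A / (12 * √m)))) := by
    refine (Finset.sum_le_card_nsmul _ _ (2 * ENNReal.ofReal (Real.exp (1 - A / (12 * √m))))
      fun z _ => ?_).trans (le_of_eq ?_)
    · rw [mul_comm]
      gcongr
      exact pathAvg_pow_count_le hlamM z le_rfl y
    · rw [Int.card_Icc, nsmul_eq_mul]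
      congr 1
      have : (y + A + 1 - (y - A)).toNat = 2 * A + 1 := by omega
      rw [this]; push_cast; rfl
  refine (add_le_add (add_le_add (hterm c _ hc2 rfl) (hterm (-c) _ (by rw [neg_sq, hc2])
    (by ring))) hcount).trans ?_
  rw [ENNReal.ofReal_mul (by positivity), ENNReal.ofReal_add (by positivity) (by positivity),
    ENNReal.ofReal_mul (by norm_num), ENNReal.ofReal_mul (by norm_num),
    ENNReal.ofReal_add (by positivity) (by positivity),
    ENNReal.ofReal_add (by positivity) (by positivity), ENNReal.ofReal_mul (by norm_num)]
  simp only [ENNReal.ofReal_ofNat, ENNReal.ofReal_natCast, ENNReal.ofReal_one]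
  generalize ENNReal.ofReal (Real.exp (1 - A / (12 * √m))) = E
  calc (m + 1) * E + (m + 1) * E + (2 * A + 1) * (2 * E)
      = (2 * (m + 1) + 2 * (2 * A + 1)) * E := by ring
    _ ≤ _ := by gcongr; norm_num

theorem dependsOn_horizLaw (l : List ℤ) (x : ℤ) :
    DependsOn (fun e : ℤ → ℤˣ => horizLaw (l.map e) x) (l.toFinset : Finset ℤ) := by
  intro e e' h
  have : l.map e = l.map e' := List.map_congr_left fun z hz => h z (by simpa using hz)
  simp [this]

theorem lintegral_pathAvg {ν : Measure (ℤ → ℤˣ)} (m : ℕ) (y : ℤ) (F : (ℤ → ℤˣ) → List ℤ → ℝ≥0∞)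
    (hF : ∀ l, Measurable fun e => F e l) :
    Measurable (fun e => pathAvg m y (F e)) ∧
      ∫⁻ e, pathAvg m y (F e) ∂ν = pathAvg m y fun l => ∫⁻ e, F e l ∂ν := by
  induction m generalizing y F with
  | zero => exact ⟨hF _, rfl⟩
  | succ m ih =>
    have h := fun y' => ih y' (fun e l => F e (y :: l)) fun l => hF _
    refine ⟨((h _).1.add (h _).1).const_mul _, ?_⟩
    simp only [pathAvg]
    rw [lintegral_const_mul _ ((h _).1.fun_add (h _).1), lintegral_add_left (h _).1, (h _).2,
      (h _).2]

section

variable {ν : Measure (ℤ → ℤˣ)} [IsProbabilityMeasure ν]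

/-- Take K ≈ m^δ, L ≈ m^(1/8) and t = m^(-3/4+3δ). Then t²Q lies between m^(5δ)/5 and 4m^(7δ), so
the Gaussian term is O(m^(-δ)). Since L^(-β) ≤ m^(-10δ), the cross term is of order m^(-10δ+2δ+7δ).
The constraint KtLA ≤ 1 has exponent -1/8 + 5δ ≤ -1/16, because δ = β/80 ≤ 1/80. -/
theorem measureReal_abs_signSum_le (hν : PositivelyCorrelated ν)
    (hmean : ∀ y, ∫ e : ℤ → ℤˣ, ((e y : ℤ) : ℝ) ∂ν = 0) {β C : ℝ}
    (hβ1 : β ≤ 1) (hC : ∀ (s : Finset ℤ) y, ∑ z ∈ s, pairCov ν y z * |((y - z : ℤ) : ℝ)| ^ β ≤ C)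
    {δ : ℝ} (hδ : 0 < δ) (hδβ : 80 * δ = β) {m : ℕ} (hm : 1 ≤ m)
    (hm8 : 8 * (m : ℝ) ^ (-(1 / 16) : ℝ) ≤ 1) {A : ℕ} (hA : (A : ℝ) ≤ 2 * (m : ℝ) ^ (1 / 2 + δ))
    {y : ℤ} {l : List ℤ} (hl : l.length = m + 1) (hs : Spread A y l) :
    ν.real {e | |signSum (l.map e)| ≤ (m : ℝ) ^ (1 / 2 + δ)} ≤
      (84 + 256 * C) * (m : ℝ) ^ (-δ) := by
  have hβ0 : 0 < β := by linarith
  have hC0 : 0 ≤ C := by simpa using hC ∅ 0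
  have hm1 : (1 : ℝ) ≤ m := by exact_mod_cast hm
  have hm0 : (0 : ℝ) < m := by linarith
  have hone : ∀ {p : ℝ}, 0 ≤ p → 1 ≤ (m : ℝ) ^ p := fun hp => Real.one_le_rpow hm1 hp
  have hmono : ∀ {p q : ℝ}, p ≤ q → (m : ℝ) ^ p ≤ (m : ℝ) ^ q := fun h =>
    Real.rpow_le_rpow_of_exponent_le hm1 h
  set K := ⌈(m : ℝ) ^ δ⌉₊ with hK
  set L := ⌈(m : ℝ) ^ (1 / 8 : ℝ)⌉₊ with hL
  set t := (m : ℝ) ^ (-(3 / 4) + 3 * δ) with ht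
  have ht0 : 0 < t := Real.rpow_pos_of_pos hm0 _
  have hK1 : (m : ℝ) ^ δ ≤ K := Nat.le_ceil _
  have hK2 : (K : ℝ) ≤ 2 * (m : ℝ) ^ δ := ceil_le_two_mul (hone hδ.le)
  have hL1 : (m : ℝ) ^ (1 / 8 : ℝ) ≤ L := Nat.le_ceil _
  have hL2 : (L : ℝ) ≤ 2 * (m : ℝ) ^ (1 / 8 : ℝ) := ceil_le_two_mul (hone (by norm_num))
  have hKpos : 0 < K := Nat.ceil_pos.2 (Real.rpow_pos_of_pos hm0 _)
  have hLpos : 0 < L := Nat.ceil_pos.2 (Real.rpow_pos_of_pos hm0 _)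
  have hKr : (0 : ℝ) < K := by exact_mod_cast hKpos
  set Q := ∑ z ∈ l.toFinset, (l.count z : ℝ) ^ 2 with hQ
  have ht2 : t ^ 2 = (m : ℝ) ^ (-(3 / 2) + 6 * δ) := by
    rw [ht, ← Real.rpow_natCast, ← Real.rpow_mul hm0.le]; congr 1; push_cast; ring
  have hQlow : (m : ℝ) ^ δ / 5 ≤ t ^ 2 * Q := by
    have h1 := hs.length_sq_le
    rw [hl, ← hQ] at h1
    have hQ0 : 0 ≤ Q := Finset.sum_nonneg fun _ _ => sq_nonneg _
    have h2 : (m : ℝ) ^ 2 ≤ 5 * (m : ℝ) ^ (1 / 2 + δ) * Q := by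
      calc (m : ℝ) ^ 2 ≤ ((m + 1 : ℕ) : ℝ) ^ 2 := by gcongr; linarith
        _ ≤ (2 * A + 1) * Q := h1
        _ ≤ _ := by
          gcongr
          linarith [hone (p := 1 / 2 + δ) (by linarith)]
    have h3 : (m : ℝ) ^ (-(3 / 2) + 6 * δ) * (m : ℝ) ^ 2 =
        (m : ℝ) ^ (5 * δ) * (m : ℝ) ^ (1 / 2 + δ) := by
      rw [← Real.rpow_natCast, ← Real.rpow_add hm0, ← Real.rpow_add hm0]
      congr 1; push_cast; ring
    have h4 : 0 < (m : ℝ) ^ (1 / 2 + δ) := Real.rpow_pos_of_pos hm0 _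
    have h5 : (m : ℝ) ^ (5 * δ) ≤ 5 * (t ^ 2 * Q) := by
      refine le_of_mul_le_mul_right ?_ h4
      rw [← h3, ht2]
      have := mul_le_mul_of_nonneg_left h2 (Real.rpow_pos_of_pos hm0 (-(3 / 2) + 6 * δ)).le
      linarith
    have := hmono (p := δ) (q := 5 * δ) (by linarith)
    linarith
  have hQup : t ^ 2 * Q ≤ 4 * (m : ℝ) ^ (7 * δ) := by
    have h1 := hs.sum_sq_le
    rw [hl, ← hQ] at h1
    calc t ^ 2 * Q ≤ (m : ℝ) ^ (-(3 / 2) + 6 * δ) * ((2 * (m : ℝ) ^ (1 : ℝ)) *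
          (2 * (m : ℝ) ^ (1 / 2 + δ))) := by
          rw [ht2]
          gcongr
          refine h1.trans ?_
          gcongr
          push_cast
          rw [Real.rpow_one]
          linarith
      _ = 4 * ((m : ℝ) ^ (-(3 / 2) + 6 * δ) * ((m : ℝ) ^ (1 : ℝ) * (m : ℝ) ^ (1 / 2 + δ))) := by
          ring
      _ = _ := by
          rw [← Real.rpow_add hm0, ← Real.rpow_add hm0]; congr 2; ring
  have htB : K * t * L * A ≤ 1 := by
    calc K * t * L * A ≤ (2 * (m : ℝ) ^ δ) * t * (2 * (m : ℝ) ^ (1 / 8 : ℝ)) *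
          (2 * (m : ℝ) ^ (1 / 2 + δ)) := by gcongr
      _ = 8 * ((m : ℝ) ^ δ * t * (m : ℝ) ^ (1 / 8 : ℝ) * (m : ℝ) ^ (1 / 2 + δ)) := by ring
      _ ≤ 8 * (m : ℝ) ^ (-(1 / 16) : ℝ) := by
          rw [ht, ← Real.rpow_add hm0, ← Real.rpow_add hm0, ← Real.rpow_add hm0]
          gcongr 8 * ?_
          exact hmono (by linarith)
      _ ≤ 1 := hm8
  have hT : (m : ℝ) ^ (1 / 2 + δ) ≤ 1 / (K * t) := by
    rw [le_div_iff₀ (by positivity)]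
    calc (m : ℝ) ^ (1 / 2 + δ) * (K * t) ≤ (m : ℝ) ^ (1 / 2 + δ) * ((2 * (m : ℝ) ^ δ) * t) := by
          gcongr
      _ = 2 * ((m : ℝ) ^ (1 / 2 + δ) * ((m : ℝ) ^ δ * t)) := by ring
      _ ≤ 2 * (m : ℝ) ^ (-(1 / 16) : ℝ) := by
          rw [ht, ← Real.rpow_add hm0, ← Real.rpow_add hm0]
          gcongr 2 * ?_
          exact hmono (by linarith)
      _ ≤ 1 := by
          have : 0 < (m : ℝ) ^ (-(1 / 16) : ℝ) := Real.rpow_pos_of_pos hm0 _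
          linarith
  have hsub : {e | |signSum (l.map e)| ≤ (m : ℝ) ^ (1 / 2 + δ)} ⊆
      {e | |linSum l.toFinset (fun z => (l.count z : ℝ)) e| ≤ 1 / (K * t)} := by
    intro e he
    have he' : |signSum (l.map e)| ≤ (m : ℝ) ^ (1 / 2 + δ) := he
    rw [signSum_map] at he'
    exact he'.trans hT
  refine (measureReal_mono hsub).trans ?_
  refine (measureReal_abs_linSum_le hν hmean hβ0 hβ1 hC l.toFinset (fun z => Nat.cast_nonneg _)
    (fun z => Nat.cast_le.2 (hs.2 z)) hLpos hKpos ht0 htB).trans ?_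
  rw [← hQ]
  have hδ0 : 0 < (m : ℝ) ^ δ := Real.rpow_pos_of_pos hm0 _
  have hneg : (m : ℝ) ^ (-δ) = ((m : ℝ) ^ δ)⁻¹ := Real.rpow_neg hm0.le _
  have e1 : 4 / (K : ℝ) ≤ 4 * (m : ℝ) ^ (-δ) := by
    rw [hneg, ← div_eq_mul_inv]; gcongr
  have e2 : Real.exp (-(t ^ 2 * Q) / 4) ≤ 20 * (m : ℝ) ^ (-δ) := by
    have h1 : (m : ℝ) ^ δ / 20 ≤ Real.exp (t ^ 2 * Q / 4) := by
      linarith [Real.add_one_le_exp (t ^ 2 * Q / 4)]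
    rw [neg_div, Real.exp_neg, hneg]
    calc (Real.exp (t ^ 2 * Q / 4))⁻¹ ≤ ((m : ℝ) ^ δ / 20)⁻¹ := by gcongr
      _ = _ := by field_simp
  have e3 : (L : ℝ) ^ (-β) * C * (K ^ 2 * (t ^ 2 * Q)) ≤ 16 * C * (m : ℝ) ^ (-δ) := by
    have h1 : (L : ℝ) ^ (-β) ≤ (m : ℝ) ^ (-(10 * δ)) := by
      calc (L : ℝ) ^ (-β) ≤ ((m : ℝ) ^ (1 / 8 : ℝ)) ^ (-β) :=
            Real.rpow_le_rpow_of_nonpos (Real.rpow_pos_of_pos hm0 _) hL1 (by linarith)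
        _ = _ := by rw [← Real.rpow_mul hm0.le]; congr 1; linarith
    have hL0 : 0 ≤ (L : ℝ) ^ (-β) := Real.rpow_nonneg (Nat.cast_nonneg _) _
    calc (L : ℝ) ^ (-β) * C * (K ^ 2 * (t ^ 2 * Q))
        ≤ (m : ℝ) ^ (-(10 * δ)) * C * ((2 * (m : ℝ) ^ δ) ^ 2 * (4 * (m : ℝ) ^ (7 * δ))) := by
          gcongr
      _ = 16 * C * ((m : ℝ) ^ (-(10 * δ)) * ((m : ℝ) ^ δ * (m : ℝ) ^ δ * (m : ℝ) ^ (7 * δ))) := by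
          ring
      _ = _ := by
          rw [← Real.rpow_add hm0, ← Real.rpow_add hm0, ← Real.rpow_add hm0]
          congr 2; ring
  linarith

/-- Split the environments by the size of the sign sum: the local bound on the rare event that it is
small, the Chernoff bound elsewhere. -/
theorem lintegral_horizLaw_le (hν : PositivelyCorrelated ν)
    (hmean : ∀ y, ∫ e : ℤ → ℤˣ, ((e y : ℤ) : ℝ) ∂ν = 0) {β C : ℝ}
    (hβ1 : β ≤ 1) (hC : ∀ (s : Finset ℤ) y, ∑ z ∈ s, pairCov ν y z * |((y - z : ℤ) : ℝ)| ^ β ≤ C)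
    {δ : ℝ} (hδ : 0 < δ) (hδβ : 80 * δ = β) {m : ℕ} (hm : 16 ≤ m)
    (hm8 : 8 * (m : ℝ) ^ (-(1 / 16) : ℝ) ≤ 1) {A : ℕ} (hA : (A : ℝ) ≤ 2 * (m : ℝ) ^ (1 / 2 + δ))
    {y : ℤ} {l : List ℤ} (hl : l.length = m + 1) (hs : Spread A y l) (x : ℤ) :
    ∫⁻ e, horizLaw (l.map e) x ∂ν ≤
      ENNReal.ofReal (2 / √m * ((84 + 256 * C) * (m : ℝ) ^ (-δ)) +
        Real.exp (1 + |(x : ℝ)| - (m : ℝ) ^ δ / 4)) := by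
  have hm0 : (0 : ℝ) < m := by exact_mod_cast (by omega : 0 < m)
  have hC0 : 0 ≤ C := by simpa using hC ∅ 0
  set S := {e : ℤ → ℤˣ | |signSum (l.map e)| ≤ (m : ℝ) ^ (1 / 2 + δ)} with hS
  have hSm : MeasurableSet S := by
    simp only [hS, signSum_map]
    exact measurableSet_le
      (measurable_of_dependsOn (dependsOn_linSum (Finset.Subset.refl _) _)).abs measurable_const
  have hpt : ∀ e, horizLaw (l.map e) x ≤
      S.indicator (fun _ => ENNReal.ofReal (2 / √m)) e +
        ENNReal.ofReal (Real.exp (1 + |(x : ℝ)| - (m : ℝ) ^ δ / 4)) := by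
    intro e
    have hlen : (l.map e).length = m + 1 := by rw [List.length_map, hl]
    by_cases he : e ∈ S
    · rw [Set.indicator_of_mem he]
      refine le_add_right ((horizLaw_le_inv_sqrt _ (fun h => by simp [h] at hlen) x).trans ?_)
      rw [hlen]
      refine ENNReal.ofReal_le_ofReal ?_
      have : 0 < √(m : ℝ) := Real.sqrt_pos.2 hm0
      gcongr
      linarith
    · rw [Set.indicator_of_notMem he, zero_add]
      have he' : (m : ℝ) ^ (1 / 2 + δ) < |signSum (l.map e)| := not_le.1 he
      refine (horizLaw_le_exp_neg_abs (by omega) x).trans ?_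
      rw [hlen]
      refine ENNReal.ofReal_le_ofReal (Real.exp_le_exp.2 ?_)
      have h1 : √((m + 1 : ℕ) : ℝ) ≤ 2 * √m := by
        rw [show (2 : ℝ) * √m = √(4 * m) by
          rw [Real.sqrt_mul (by norm_num), show (4 : ℝ) = 2 ^ 2 by norm_num,
            Real.sqrt_sq (by norm_num)]]
        apply Real.sqrt_le_sqrt
        push_cast
        have : (16 : ℝ) ≤ m := by exact_mod_cast hm
        linarith
      have h2 : (m : ℝ) ^ δ / 4 ≤ |signSum (l.map e)| / (2 * √((m + 1 : ℕ) : ℝ)) := by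
        have hpos : 0 < √((m + 1 : ℕ) : ℝ) := Real.sqrt_pos.2 (by positivity)
        rw [le_div_iff₀ (by positivity)]
        have h3 : (m : ℝ) ^ (1 / 2 + δ) = √m * (m : ℝ) ^ δ := by
          rw [Real.rpow_add hm0, Real.sqrt_eq_rpow]
        have h4 : 0 < (m : ℝ) ^ δ := Real.rpow_pos_of_pos hm0 _
        nlinarith
      linarith
  refine (lintegral_mono hpt).trans ?_
  rw [lintegral_add_right _ measurable_const, lintegral_indicator_const hSm, lintegral_const,
    measure_univ, mul_one, ENNReal.ofReal_add (by positivity) (Real.exp_pos _).le,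
    ENNReal.ofReal_mul (by positivity)]
  gcongr
  rw [← ENNReal.ofReal_toReal (measure_ne_top ν S)]
  exact ENNReal.ofReal_le_ofReal
    (measureReal_abs_signSum_le hν hmean hβ1 hC hδ hδβ (by omega) hm8 hA hl hs)

theorem measurable_greenTerm (v u : ℤ × ℤ) (m : ℕ) : Measurable fun e => greenTerm e v m u :=
  -- Only the measurability half is used, so the measure is a dummy.
  (lintegral_pathAvg (ν := Measure.dirac fun _ => 1) m u.2 _ fun l =>
    (measurable_of_dependsOn (dependsOn_horizLaw l _)).const_mul _).1

theorem lintegral_greenTerm_le_one (v u : ℤ × ℤ) (m : ℕ) :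
    ∫⁻ e, greenTerm e v m u ∂ν ≤ 1 := by
  have : ∀ e, greenTerm e v m u ≤ 1 := by
    intro e
    rw [← pathAvg_const m u.2 1]
    refine pathAvg_mono' fun l _ => ?_
    split_ifs
    · rw [one_mul]; exact horizLaw_le_one _ _
    · simp
  refine (lintegral_mono this).trans ?_
  simp

/-- Spread paths contribute m^(-1/2) for the vertical endpoint times m^(-1/2-δ) for the horizontal
one, plus an exponential term. For the others the point mass is bounded by 1, and
`pathAvg_not_spread_le` makes their total weight negligible. -/
theorem lintegral_greenTerm_le (hν : PositivelyCorrelated ν)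
    (hmean : ∀ y, ∫ e : ℤ → ℤˣ, ((e y : ℤ) : ℝ) ∂ν = 0) {β C : ℝ}
    (hβ1 : β ≤ 1) (hC : ∀ (s : Finset ℤ) y, ∑ z ∈ s, pairCov ν y z * |((y - z : ℤ) : ℝ)| ^ β ≤ C)
    {δ : ℝ} (hδ : 0 < δ) (hδβ : 80 * δ = β) {m : ℕ} (hm : 16 ≤ m)
    (hm8 : 8 * (m : ℝ) ^ (-(1 / 16) : ℝ) ≤ 1)
    (hexp : Real.exp (-((m : ℝ) ^ δ / 12)) ≤ (m : ℝ) ^ (-3 : ℝ)) (v u : ℤ × ℤ) :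
    ∫⁻ e, greenTerm e v m u ∂ν ≤ ENNReal.ofReal
      ((2 * (84 + 256 * C) + Real.exp (1 + |((v.1 - u.1 : ℤ) : ℝ)|) + 100) *
        (m : ℝ) ^ (-(1 + δ))) := by
  classical
  have hm16 : (16 : ℝ) ≤ m := by exact_mod_cast hm
  have hm0 : (0 : ℝ) < m := by linarith
  have hm1 : (1 : ℝ) ≤ m := by linarith
  have hC0 : 0 ≤ C := by simpa using hC ∅ 0
  set x := v.1 - u.1
  set A := ⌈(m : ℝ) ^ (1 / 2 + δ)⌉₊ with hAdef
  have hA1 : (m : ℝ) ^ (1 / 2 + δ) ≤ A := Nat.le_ceil _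
  have hA2 : (A : ℝ) ≤ 2 * (m : ℝ) ^ (1 / 2 + δ) :=
    ceil_le_two_mul (Real.one_le_rpow hm1 (by linarith))
  set r := 2 / √m * ((84 + 256 * C) * (m : ℝ) ^ (-δ)) +
    Real.exp (1 + |(x : ℝ)| - (m : ℝ) ^ δ / 4) with hr
  have hr0 : 0 ≤ r := by positivity
  have hmain : ∫⁻ e, greenTerm e v m u ∂ν ≤ ENNReal.ofReal r * ENNReal.ofReal (1 / √m) +
      ENNReal.ofReal ((4 * (m + 1) + 2 * (2 * A + 1)) * Real.exp (1 - A / (12 * √m))) := by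
    unfold greenTerm
    rw [(lintegral_pathAvg m u.2 _ fun l =>
      (measurable_of_dependsOn (dependsOn_horizLaw l _)).const_mul _).2]
    calc _ ≤ pathAvg m u.2 (fun l => ENNReal.ofReal r * (if l.getLast? = some v.2 then 1 else 0) +
          if Spread A u.2 l then 0 else 1) := by
          refine pathAvg_mono' fun l hl => ?_
          rw [lintegral_const_mul _ (measurable_of_dependsOn (dependsOn_horizLaw l _))]
          by_cases hs : Spread A u.2 l
          · rw [if_pos hs, add_zero, mul_comm]
            gcongr
            exact lintegral_horizLaw_le hν hmean hβ1 hC hδ hδβ hm hm8 hA2 hl hs x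
          · rw [if_neg hs]
            refine le_add_left ?_
            have h1 : ∫⁻ e, horizLaw (l.map e) (v.1 - u.1) ∂ν ≤ 1 :=
              (lintegral_mono fun e => horizLaw_le_one _ _).trans (by simp)
            split_ifs
            · simpa using h1
            · simp
      _ ≤ _ := by
          rw [pathAvg_add, pathAvg_const_mul]
          gcongr
          · exact (hitProb_le u.2 v.2).resolve_right (by omega)
          · exact pathAvg_not_spread_le (by omega) u.2
  refine hmain.trans ?_
  rw [← ENNReal.ofReal_mul hr0, ← ENNReal.ofReal_add (by positivity) (by positivity)]
  refine ENNReal.ofReal_le_ofReal ?_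
  set w := (m : ℝ) ^ (-(1 + δ)) with hw
  have hs0 : 0 < √(m : ℝ) := Real.sqrt_pos.2 hm0
  have hs1 : 1 / √(m : ℝ) ≤ 1 := by
    rw [div_le_one hs0]; exact Real.one_le_sqrt.2 hm1
  have hδ1 : δ ≤ 1 / 80 := by linarith
  have e1 : 2 / √m * ((84 + 256 * C) * (m : ℝ) ^ (-δ)) * (1 / √m) = 2 * (84 + 256 * C) * w := by
    have h1 : w = (m : ℝ)⁻¹ * (m : ℝ) ^ (-δ) := by
      rw [hw, neg_add, Real.rpow_add hm0, Real.rpow_neg_one]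
    have h2 : 1 / √(m : ℝ) * (1 / √m) = (m : ℝ)⁻¹ := by
      rw [← mul_div_mul_comm, Real.mul_self_sqrt hm0.le, one_mul, one_div]
    rw [h1, ← h2]; ring
  have hexp3 : Real.exp (-((m : ℝ) ^ δ / 12)) ≤ w :=
    hexp.trans (Real.rpow_le_rpow_of_exponent_le hm1 (by linarith))
  have hδ0 : 0 ≤ (m : ℝ) ^ δ := Real.rpow_nonneg hm0.le _
  have e2 : Real.exp (1 + |(x : ℝ)| - (m : ℝ) ^ δ / 4) * (1 / √m) ≤
      Real.exp (1 + |(x : ℝ)|) * w := by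
    calc _ ≤ Real.exp (1 + |(x : ℝ)| - (m : ℝ) ^ δ / 4) * 1 := by gcongr
      _ ≤ Real.exp (1 + |(x : ℝ)| + -((m : ℝ) ^ δ / 12)) := by
          rw [mul_one]; apply Real.exp_le_exp.2; linarith
      _ = Real.exp (1 + |(x : ℝ)|) * Real.exp (-((m : ℝ) ^ δ / 12)) := Real.exp_add _ _
      _ ≤ _ := by gcongr
  have e3 : (4 * ((m : ℝ) + 1) + 2 * (2 * A + 1)) * Real.exp (1 - A / (12 * √m)) ≤ 100 * w := by
    have h1 : (m : ℝ) ^ (1 / 2 + δ) ≤ m := by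
      calc _ ≤ (m : ℝ) ^ (1 : ℝ) := Real.rpow_le_rpow_of_exponent_le hm1 (by linarith)
        _ = m := Real.rpow_one _
    have h2 : 4 * ((m : ℝ) + 1) + 2 * (2 * A + 1) ≤ 18 * m := by linarith
    have h3 : (m : ℝ) ^ δ / 12 ≤ A / (12 * √m) := by
      rw [div_le_div_iff₀ (by norm_num) (by positivity)]
      have : (m : ℝ) ^ (1 / 2 + δ) = √m * (m : ℝ) ^ δ := by
        rw [Real.rpow_add hm0, Real.sqrt_eq_rpow]
      rw [this] at hA1
      linarith
    have h4 : Real.exp (1 - A / (12 * √m)) ≤ 3 * (m : ℝ) ^ (-3 : ℝ) := by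
      calc _ ≤ Real.exp (1 + -((m : ℝ) ^ δ / 12)) := Real.exp_le_exp.2 (by linarith)
        _ = Real.exp 1 * Real.exp (-((m : ℝ) ^ δ / 12)) := Real.exp_add _ _
        _ ≤ _ := by gcongr; linarith [Real.exp_one_lt_d9]
    calc _ ≤ (18 * (m : ℝ)) * (3 * (m : ℝ) ^ (-3 : ℝ)) := by gcongr
      _ = 54 * ((m : ℝ) ^ (1 : ℝ) * (m : ℝ) ^ (-3 : ℝ)) := by rw [Real.rpow_one]; ring
      _ = 54 * (m : ℝ) ^ (-2 : ℝ) := by rw [← Real.rpow_add hm0]; norm_num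
      _ ≤ 54 * w := by gcongr 54 * ?_; exact Real.rpow_le_rpow_of_exponent_le hm1 (by linarith)
      _ ≤ _ := by
          have : 0 < w := Real.rpow_pos_of_pos hm0 _
          linarith
  rw [hr, add_mul]
  linarith

theorem lintegral_green_ne_top (hν : PositivelyCorrelated ν)
    (hmean : ∀ y, ∫ e : ℤ → ℤˣ, ((e y : ℤ) : ℝ) ∂ν = 0) {β C : ℝ} (hβ0 : 0 < β)
    (hβ1 : β ≤ 1) (hC : ∀ (s : Finset ℤ) y, ∑ z ∈ s, pairCov ν y z * |((y - z : ℤ) : ℝ)| ^ β ≤ C)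
    (v u : ℤ × ℤ) : ∫⁻ e, green e v u ∂ν ≠ ∞ := by
  obtain ⟨δ, hδβ⟩ : ∃ δ, 80 * δ = β := ⟨β / 80, by ring⟩
  have hδ : 0 < δ := by linarith
  unfold green
  rw [lintegral_const_mul _ (Measurable.tsum fun m => measurable_greenTerm v u m),
    lintegral_tsum fun m => (measurable_greenTerm v u m).aemeasurable]
  refine ENNReal.mul_ne_top (by finiteness) ?_
  have hcast : Tendsto (fun m : ℕ => (m : ℝ)) atTop atTop := tendsto_natCast_atTop_atTop
  have h8 : ∀ᶠ m : ℕ in atTop, 8 * (m : ℝ) ^ (-(1 / 16) : ℝ) ≤ 1 := by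
    have := ((tendsto_rpow_neg_atTop (y := 1 / 16) (by norm_num)).comp hcast).const_mul 8
    rw [mul_zero] at this
    filter_upwards [this.eventually (ge_mem_nhds one_pos)] with m hm using hm
  have hexp : ∀ᶠ m : ℕ in atTop, Real.exp (-((m : ℝ) ^ δ / 12)) ≤ (m : ℝ) ^ (-3 : ℝ) := by
    -- Applied at the point m^δ, where the power -3/δ becomes m^(-3).
    have h1 := (isLittleO_exp_neg_mul_rpow_atTop (a := 1 / 12) (by norm_num) (-3 / δ)).bound one_pos
    filter_upwards [((tendsto_rpow_atTop hδ).comp hcast).eventually h1] with m hm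
    simp only [Function.comp_apply, one_mul, Real.norm_eq_abs, Real.abs_exp] at hm
    rw [abs_of_nonneg (by positivity), ← Real.rpow_mul (Nat.cast_nonneg m),
      mul_div_cancel₀ _ hδ.ne'] at hm
    refine le_trans (le_of_eq ?_) hm
    congr 1; ring
  obtain ⟨N, hN⟩ := eventually_atTop.1 ((eventually_ge_atTop 16).and (h8.and hexp))
  set D := 2 * (84 + 256 * C) + Real.exp (1 + |((v.1 - u.1 : ℤ) : ℝ)|) + 100
  have hC0 : 0 ≤ C := by simpa using hC ∅ 0
  have hsum : Summable fun m : ℕ => D * (m : ℝ) ^ (-(1 + δ)) :=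
    (Real.summable_nat_rpow.2 (by linarith)).mul_left D
  have htail : ∑' m, ∫⁻ e, greenTerm e v (m + N) u ∂ν ≠ ∞ := by
    refine ne_top_of_le_ne_top ((summable_nat_add_iff N).2 hsum).tsum_ofReal_ne_top
      (ENNReal.tsum_le_tsum fun m => ?_)
    obtain ⟨g1, g2, g3⟩ := hN (m + N) (by omega)
    exact lintegral_greenTerm_le hν hmean hβ1 hC hδ hδβ g1 g2 g3 v u
  rw [← ENNReal.summable.sum_add_tsum_nat_add' (k := N)]
  refine ENNReal.add_ne_top.2 ⟨ENNReal.sum_ne_top.2 fun m _ => ?_, htail⟩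
  exact ne_top_of_le_ne_top ENNReal.one_ne_top (lintegral_greenTerm_le_one v u m)

theorem measurable_green (v u : ℤ × ℤ) : Measurable fun e => green e v u :=
  (Measurable.tsum fun m => measurable_greenTerm v u m).const_mul _

end

end

end OrientedLattice

theorem theorem1 {Ω : Type*} [MeasurableSpace Ω] (P : Measure Ω) [IsProbabilityMeasure P]
    (ε : ℤ → Ω → ℤˣ) (hmeas : ∀ y, Measurable (ε y))
    (hstat : OrientedLattice.IsStationary P ε)
    (hsymm : OrientedLattice.IsSymmetric P ε)
    (hassoc : OrientedLattice.IsAssociated P ε)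
    (α : ℝ) (hα : 1 < α)
    (hdecay : OrientedLattice.correlation P ε
      =O[comap (fun y : ℤ => |y|) atTop] fun y : ℤ => |(y : ℝ)| ^ (-α)) :
    ∀ᵐ e ∂(OrientedLattice.fieldLaw P ε), OrientedLattice.IsTransient e := by
  have : IsProbabilityMeasure (OrientedLattice.fieldLaw P ε) :=
    Measure.isProbabilityMeasure_map (OrientedLattice.measurable_field hmeas).aemeasurable
  obtain ⟨β, C, hβ0, hβ1, hC⟩ :=
    OrientedLattice.exists_sum_pairCov_le hmeas hstat hsymm hassoc hα hdecay
  have hfin : ∀ᵐ e ∂(OrientedLattice.fieldLaw P ε), ∀ v u, OrientedLattice.green e v u < ⊤ :=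
    ae_all_iff.2 fun v => ae_all_iff.2 fun u =>
      ae_lt_top (OrientedLattice.measurable_green v u) (OrientedLattice.lintegral_green_ne_top
        (OrientedLattice.positivelyCorrelated_fieldLaw hmeas hstat hassoc)
        (OrientedLattice.integral_coord_fieldLaw hmeas hsymm) hβ0 hβ1 hC v u)
  filter_upwards [hfin] with e he
  exact OrientedLattice.isTransient_of_supersolution e (OrientedLattice.green e)
    (fun v => (OrientedLattice.green_eq e v).le) fun v u => (he v u).ne
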